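/- Let $p\in\{1,2,3\}$, $n\ge 1$ an integer, and $l>0$ real. All functions are real valued on $(0,2\pi)$, and $\|\cdot\|$ is the norm of $L^2(0,2\pi)$. Let $A^{(p)}:L^2(0,2\pi)\to L^2(0,2\pi)$, $(A^{(p)}\varphi)(x)=\frac1{(p-1)!}\int_0^x(x-t)^{p-1}\varphi(t)\,dt$; let $P_n$ be the orthogonal projection of $L^2(0,2\pi)$ onto $X_n=\mathrm{span}\{\frac1{\sqrt{2\pi}},\frac{\cos kt}{\sqrt\pi},\frac{\sin kt}{\sqrt\pi}:1\le k\le n\}$; let $A_n^{(p)}=P_nA^{(p)}P_n:X_n\to X_n$ and let $A_n^{(p)\dagger}$ be its Moore–Penrose inverse ($A_n^{(p)\dagger}b$ is the element of smallest norm among the minimizers $x\in X_n$ of $\|A_n^{(p)}x-b\|$). For $f\in L^2(0,2\pi)$ put $\xi_0=\frac1{\sqrt{2\pi}}\int_0^{2\pi}f$, $\xi_k=\frac1{\sqrt\pi}\int_0^{2\pi}f(t)\cos kt\,dt$, $\eta_k=\frac1{\sqrt\pi}\int_0^{2\pi}f(t)\sin kt\,dt$ and $\|f\|_{H^l_{per}}^2=\xi_0^2+\sum_{k\ge1}(1+k^2)^l(\xi_k^2+\eta_k^2)$;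 $H^l_{per}(0,2\pi)$ is the set of $f$ for which this is finite. Let $C^{(1)}=\sqrt3$, $C^{(2)}=11.8040$, $C^{(3)}=345.0754$, and $\gamma^{(p)}=1+\kappa^{(p)}$, where $$(\kappa^{(1)})^2=\tfrac{2}{\pi^2}+\tfrac4{\pi^2},\qquad (\kappa^{(2)})^2=2+4+\pi^2+\tfrac92+9+25,$$ $$(\kappa^{(3)})^2=(11\sqrt2)^2+23^2+(11\pi)^2+\left(\tfrac{44\sqrt2}{3}\right)^2+30^2+48^2,$$ and let $\Delta_p=\sum_{k=0}^{p-1}\frac{\|x^k\|}{k!}$. **Theorem 7.2.** Let $y\in H^p(0,2\pi)$ (weak derivatives up to order $p$ in $L^2(0,2\pi)$), with $y^{(p)}\in H^l_{per}(0,2\pi)$. Let $y^{(k)}(0)$, $0\le k\le p-1$, be the initial values of the representative of $y$ in $C^{p-1}[0,2\pi]$ whose derivative of order $p-1$ is absolutely continuous with derivative in $L^2$. Let $y^\delta\in L^2(0,2\pi)$ with $\|y^\delta-y\|\le\delta$, and let $\Lambda_0(0),\dots,\Lambda_{p-1}(0)\in\mathbb R$ with $|\Lambda_k(0)-y^{(k)}(0)|\le\delta_i$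 for $k=0,\dots,p-1$. Then $$\Big\|A_n^{(p)\dagger}P_n\Big(y^\delta-\sum_{k=0}^{p-1}\frac{\Lambda_k(0)}{k!}x^k\Big)-y^{(p)}\Big\|\le C^{(p)}n^p\delta+\Delta_pC^{(p)}n^p\delta_i+(\gamma^{(p)}+1)\frac1{n^l}\|y^{(p)}\|_{H^l_{per}}.$$ If moreover $\delta_i=\delta$, the left-hand side is at most $(\Delta_p+1)C^{(p)}n^p\delta+(\gamma^{(p)}+1)\frac1{n^l}\|y^{(p)}\|_{H^l_{per}}$. -/

import Mathlib

open MeasureTheory Set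

namespace NumDiff

noncomputable section

/-! ### The space `L²(0, 2π)` -/

/-- Lebesgue measure on `(0, 2π)`. -/
def μ : Measure ℝ := volume.restrict (Ioo 0 (2 * Real.pi))

instance : IsFiniteMeasure μ := by
  unfold μ
  infer_instance

/-- The real Hilbert space `L²(0, 2π)`. -/
abbrev L2 : Type := Lp ℝ 2 μ

theorem memLp_of_continuous {f : ℝ → ℝ} (hf : Continuous f) : MemLp f 2 μ := by
  obtain ⟨C, hC⟩ := (isCompact_Icc (a := (0 : ℝ)) (b := 2 * Real.pi)).exists_bound_of_continuousOn
    hf.continuousOn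
  refine MemLp.of_bound hf.aestronglyMeasurable C ?_
  unfold μ
  filter_upwards [ae_restrict_mem measurableSet_Ioo] with x hx
  exact hC x (Ioo_subset_Icc_self hx)

/-- The class in `L²(0, 2π)` of a continuous function. -/
def ofContinuous (f : ℝ → ℝ) (hf : Continuous f) : L2 := (memLp_of_continuous hf).toLp f

/-- The monomial `x ^ k` as an element of `L²(0, 2π)`. -/
def monomial (k : ℕ) : L2 := ofContinuous (fun x => x ^ k) (continuous_pow k)

/-! ### Weak derivatives and the Sobolev space `H^p(0, 2π)` -/

/-- `ζ` is the weak derivative `D^k y`, tested against `C_0^∞(0, 2π)`. -/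
def HasWeakDeriv (k : ℕ) (y ζ : L2) : Prop :=
  ∀ φ : ℝ → ℝ, ContDiff ℝ (⊤ : ℕ∞) φ → HasCompactSupport φ →
    tsupport φ ⊆ Ioo 0 (2 * Real.pi) →
    ∫ x, ζ x * φ x ∂μ = (-1) ^ k * ∫ x, y x * iteratedDeriv k φ x ∂μ

/-- `y ∈ H^p(0, 2π)`: the weak derivatives `D^1 y, …, D^p y` exist in `L²(0, 2π)`. -/
def MemH (p : ℕ) (y : L2) : Prop :=
  ∀ k ∈ Finset.Icc 1 p, ∃ ζ : L2, HasWeakDeriv k y ζ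

/-- The weak derivative `D^k y` (unique when it exists; arbitrary otherwise). -/
def weakDeriv (k : ℕ) (y : L2) : L2 := Classical.epsilon (HasWeakDeriv k y)

/-- `u` restricted to `[0, 2π]` belongs to the fine function space `𝒰^p[0, 2π]`, for `p ≥ 1`:
`u` is of class `C^{p-1}` on `[0, 2π]` and `u^{(p-1)}(x) = α + ∫_0^x Ψ` with `Ψ ∈ L²(0, 2π)`. -/
def MemU (p : ℕ) (u : ℝ → ℝ) : Prop :=
  ContDiffOn ℝ ((p - 1 : ℕ) : WithTop ℕ∞) u (Icc 0 (2 * Real.pi)) ∧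
    ∃ (Ψ : L2) (α : ℝ), ∀ x ∈ Icc 0 (2 * Real.pi),
      iteratedDerivWithin (p - 1) u (Icc 0 (2 * Real.pi)) x = α + ∫ t in (0 : ℝ)..x, Ψ t

/-- The representative in `𝒰^p[0, 2π]` of a class `y ∈ H^p(0, 2π)`, `p ≥ 1`. Its values on
`[0, 2π]` are uniquely determined by `y`; outside of `[0, 2π]` they are arbitrary. -/
def fineRep (p : ℕ) (y : L2) : ℝ → ℝ :=
  Classical.epsilon fun u : ℝ → ℝ => MemU p u ∧ ⇑y =ᵐ[μ] u

/-- The initial value `y^{(k)}(0)`, `k < p`, of `y ∈ H^p(0, 2π)`: the one-sided derivative at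
the endpoint `0` of the fine representative. -/
def initialValue (p k : ℕ) (y : L2) : ℝ :=
  iteratedDerivWithin k (fineRep p y) (Icc 0 (2 * Real.pi)) 0

/-! ### Periodic Sobolev spaces -/

/-- `ξ_0`. -/
def fourierConst (f : L2) : ℝ := 1 / √(2 * Real.pi) * ∫ t, f t ∂μ

/-- `ξ_k`. -/
def fourierCos (k : ℕ) (f : L2) : ℝ := 1 / √Real.pi * ∫ t, f t * Real.cos (k * t) ∂μ

/-- `η_k`. -/
def fourierSin (k : ℕ) (f : L2) : ℝ := 1 / √Real.pi * ∫ t, f t * Real.sin (k * t) ∂μ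

/-- The term of index `k` in the squared norm of `H^s_per`. -/
def perTerm (s : ℝ) (f : L2) (k : ℕ) : ℝ :=
  (1 + (k : ℝ) ^ 2) ^ s * (fourierCos k f ^ 2 + fourierSin k f ^ 2)

/-- `f ∈ H^s_per(0, 2π)`. -/
def MemHper (s : ℝ) (f : L2) : Prop := Summable fun k : ℕ => perTerm s f (k + 1)

/-- The norm of `H^s_per(0, 2π)`; it is only used for `f ∈ H^s_per(0, 2π)`. -/
def perNorm (s : ℝ) (f : L2) : ℝ := √(fourierConst f ^ 2 + ∑' k : ℕ, perTerm s f (k + 1))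

/-! ### The integral operator `A^{(p)}` -/

/-- The function `x ↦ 1/(p-1)! ∫_0^x (x-t)^{p-1} φ(t) dt`. -/
def integralFun (p : ℕ) (φ : L2) (x : ℝ) : ℝ :=
  1 / ((p - 1).factorial : ℝ) * ∫ t in (0 : ℝ)..x, (x - t) ^ (p - 1) * φ t

theorem integrable_coe (φ : L2) : Integrable φ μ :=
  (Lp.memLp φ).integrable (by norm_num)

theorem intervalIntegrable_kernel (m : ℕ) (φ : L2) {x : ℝ} (hx : x ∈ Ioo 0 (2 * Real.pi)) :
    IntervalIntegrable (fun t => (x - t) ^ m * φ t) volume 0 x := by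
  have h0 : IntegrableOn φ (Ioo 0 x) volume :=
    IntegrableOn.mono_set (t := Ioo 0 (2 * Real.pi)) (integrable_coe φ)
      (Ioo_subset_Ioo_right hx.2.le)
  have h : IntervalIntegrable φ volume 0 x :=
    (intervalIntegrable_iff_integrableOn_Ioo_of_le hx.1.le).2 h0
  exact h.continuousOn_mul (by fun_prop)

theorem integralFun_eq (p : ℕ) (φ : L2) {x : ℝ} (hx : x ∈ Ioo 0 (2 * Real.pi)) :
    integralFun p φ x = 1 / ((p - 1).factorial : ℝ) *
      ∫ t, (if t < x then (x - t) ^ (p - 1) else 0) * φ t ∂μ := by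
  unfold integralFun
  congr 1
  rw [intervalIntegral.integral_of_le hx.1.le, integral_Ioc_eq_integral_Ioo]
  have h1 : (fun t => (if t < x then (x - t) ^ (p - 1) else 0) * φ t)
      = (Iio x).indicator (fun t => (x - t) ^ (p - 1) * φ t) := by
    funext t
    by_cases h : t < x <;> simp [indicator, h]
  rw [h1, integral_indicator measurableSet_Iio]
  unfold μ
  rw [Measure.restrict_restrict measurableSet_Iio]
  congr 2
  ext t
  simp only [mem_Ioo, mem_inter_iff, mem_Iio]
  constructor
  · intro h
    exact ⟨h.2, h.1, h.2.trans hx.2⟩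
  · intro h
    exact ⟨h.2.1, h.1⟩

theorem memLp_integralFun (p : ℕ) (φ : L2) : MemLp (integralFun p φ) 2 μ := by
  have hae : ∀ᵐ x ∂μ, x ∈ Ioo 0 (2 * Real.pi) := ae_restrict_mem measurableSet_Ioo
  have hmeas : AEStronglyMeasurable (integralFun p φ) μ := by
    have h1 : StronglyMeasurable (fun x : ℝ => 1 / ((p - 1).factorial : ℝ) *
        ∫ t, (if t < x then (x - t) ^ (p - 1) else 0) * φ t ∂μ) := by
      refine StronglyMeasurable.const_mul ?_ _
      refine StronglyMeasurable.integral_prod_right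
        (f := fun x t : ℝ => (if t < x then (x - t) ^ (p - 1) else 0) * φ t) ?_
      refine StronglyMeasurable.mul ?_ ?_
      · refine Measurable.stronglyMeasurable ?_
        refine Measurable.ite (measurableSet_lt measurable_snd measurable_fst) ?_ measurable_const
        exact (measurable_fst.sub measurable_snd).pow_const _
      · exact (Lp.stronglyMeasurable φ).comp_measurable measurable_snd
    refine h1.aestronglyMeasurable.congr ?_
    filter_upwards [hae] with x hx
    exact (integralFun_eq p φ hx).symm
  refine MemLp.of_bound hmeas
    (1 / ((p - 1).factorial : ℝ) * ∫ t, (2 * Real.pi) ^ (p - 1) * ‖φ t‖ ∂μ) ?_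
  filter_upwards [hae] with x hx
  rw [integralFun_eq p φ hx, norm_mul, Real.norm_of_nonneg (by positivity)]
  refine mul_le_mul_of_nonneg_left ?_ (by positivity)
  refine norm_integral_le_of_norm_le ((integrable_coe φ).norm.const_mul _) ?_
  filter_upwards [hae] with t ht
  rw [norm_mul]
  refine mul_le_mul_of_nonneg_right ?_ (norm_nonneg _)
  split_ifs with h
  · rw [norm_pow, Real.norm_of_nonneg (by linarith)]
    exact pow_le_pow_left₀ (by linarith) (by linarith [hx.2, ht.1]) _
  · rw [norm_zero]
    have := Real.pi_pos
    positivity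

/-- The operator `A^{(p)} : L²(0, 2π) → L²(0, 2π)`, for `p ≥ 1`. -/
def A (p : ℕ) : L2 →ₗ[ℝ] L2 where
  toFun φ := (memLp_integralFun p φ).toLp (integralFun p φ)
  map_add' φ ψ := by
    rw [← MemLp.toLp_add]
    refine MemLp.toLp_congr _ _ ?_
    have hae : ∀ᵐ x ∂μ, x ∈ Ioo 0 (2 * Real.pi) := ae_restrict_mem measurableSet_Ioo
    filter_upwards [hae] with x hx
    simp only [Pi.add_apply, integralFun]
    rw [← mul_add, ← intervalIntegral.integral_add
      (intervalIntegrable_kernel _ φ hx) (intervalIntegrable_kernel _ ψ hx)]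
    congr 1
    rw [intervalIntegral.integral_of_le hx.1.le, intervalIntegral.integral_of_le hx.1.le,
      integral_Ioc_eq_integral_Ioo, integral_Ioc_eq_integral_Ioo]
    refine integral_congr_ae ?_
    have h2 := ae_restrict_of_ae_restrict_of_subset (Ioo_subset_Ioo_right hx.2.le)
      (Lp.coeFn_add φ ψ)
    filter_upwards [h2] with t ht
    rw [ht, Pi.add_apply]
    ring
  map_smul' c φ := by
    rw [RingHom.id_apply, ← MemLp.toLp_const_smul c (memLp_integralFun p φ)]
    refine MemLp.toLp_congr _ _ ?_
    have hae : ∀ᵐ x ∂μ, x ∈ Ioo 0 (2 * Real.pi) := ae_restrict_mem measurableSet_Ioo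
    filter_upwards [hae] with x hx
    simp only [Pi.smul_apply, smul_eq_mul, integralFun]
    have h2 := ae_restrict_of_ae_restrict_of_subset (Ioo_subset_Ioo_right hx.2.le)
      (Lp.coeFn_smul c φ)
    have h3 : ∫ t in (0 : ℝ)..x, (x - t) ^ (p - 1) * (c • φ : L2) t =
        c * ∫ t in (0 : ℝ)..x, (x - t) ^ (p - 1) * φ t := by
      rw [← intervalIntegral.integral_const_mul]
      rw [intervalIntegral.integral_of_le hx.1.le, intervalIntegral.integral_of_le hx.1.le,
        integral_Ioc_eq_integral_Ioo, integral_Ioc_eq_integral_Ioo]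
      refine integral_congr_ae ?_
      filter_upwards [h2] with t ht
      rw [ht, Pi.smul_apply, smul_eq_mul]
      ring
    rw [h3]
    ring

/-! ### Galerkin scheme -/

/-- The constant function `1/√(2π)`. -/
def basisConst : L2 := ofContinuous (fun _ => 1 / √(2 * Real.pi)) continuous_const

/-- The function `cos(kt)/√π`. -/
def basisCos (k : ℕ) : L2 :=
  ofContinuous (fun t => Real.cos (k * t) / √Real.pi) (by fun_prop)

/-- The function `sin(kt)/√π`. -/
def basisSin (k : ℕ) : L2 :=
  ofContinuous (fun t => Real.sin (k * t) / √Real.pi) (by fun_prop)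

/-- The space `X_n` of trigonometric polynomials of degree at most `n`. -/
def X (n : ℕ) : Submodule ℝ L2 :=
  Submodule.span ℝ ({basisConst} ∪ basisCos '' Icc 1 n ∪ basisSin '' Icc 1 n)

instance (n : ℕ) : FiniteDimensional ℝ (X n) :=
  FiniteDimensional.span_of_finite ℝ
    (((finite_singleton _).union ((finite_Icc 1 n).image _)).union ((finite_Icc 1 n).image _))

/-- The orthogonal projection `P_n` of `L²(0, 2π)` onto `X_n`. -/
def P (n : ℕ) : L2 →L[ℝ] X n := (X n).orthogonalProjectionOnto

/-- The operator `A_n^{(p)} = P_n A^{(p)} P_n : X_n → X_n` (where `P_n` is the identity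
on `X_n`). -/
def An (p n : ℕ) : X n →ₗ[ℝ] X n := (P n).toLinearMap ∘ₗ A p ∘ₗ (X n).subtype

/-- `x` minimizes the residual `‖T x - b‖`. -/
def IsLeastSquares {E F : Type*} [NormedAddCommGroup E] [InnerProductSpace ℝ E]
    [NormedAddCommGroup F] [InnerProductSpace ℝ F] (T : E →ₗ[ℝ] F) (b : F) (x : E) : Prop :=
  ∀ z : E, ‖T x - b‖ ≤ ‖T z - b‖

/-- The Moore–Penrose inverse `T^† b`: the element of smallest norm among those that minimize
the residual. It exists and is unique in finite dimension. -/
def moorePenrose {E F : Type*} [NormedAddCommGroup E] [InnerProductSpace ℝ E]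
    [NormedAddCommGroup F] [InnerProductSpace ℝ F] (T : E →ₗ[ℝ] F) (b : F) : E :=
  Classical.epsilon fun x : E =>
    IsLeastSquares T b x ∧ ∀ z : E, IsLeastSquares T b z → ‖x‖ ≤ ‖z‖

/-- The regularized solution `A_n^{(p)†} P_n f`, an element of `X_n ⊆ L²(0, 2π)`. -/
def galerkin (p n : ℕ) (f : L2) : L2 := (moorePenrose (An p n) (P n f) : X n)

/-- The polynomial `∑_{k<p} Λ_k/k! x^k`. -/
def taylor (p : ℕ) (Λ : ℕ → ℝ) : L2 :=
  ∑ k ∈ Finset.range p, (Λ k / (k.factorial : ℝ)) • monomial k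

/-! ### The constants -/

/-- `C^{(p)}`, for `p = 1, 2, 3`. -/
def constC (p : ℕ) : ℝ :=
  if p = 1 then √3 else if p = 2 then 11.8040 else 345.0754

/-- `(κ^{(p)})² = ∑_{i=1}^6 (C_i^{(p)})²`, for `p = 1, 2, 3`. -/
def kappaSq (p : ℕ) : ℝ :=
  if p = 1 then 0 ^ 2 + 0 ^ 2 + 0 ^ 2 + (√2 / Real.pi) ^ 2 + (2 / Real.pi) ^ 2 + 0 ^ 2
  else if p = 2 then √2 ^ 2 + 2 ^ 2 + Real.pi ^ 2 + (3 * √2 / 2) ^ 2 + 3 ^ 2 + 5 ^ 2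
  else (11 * √2) ^ 2 + 23 ^ 2 + (11 * Real.pi) ^ 2 + (44 * √2 / 3) ^ 2 + 30 ^ 2 + 48 ^ 2

/-- `γ^{(p)} = 1 + κ^{(p)}`. -/
def constGamma (p : ℕ) : ℝ := 1 + √(kappaSq p)

/-- `Δ_p = ∑_{k<p} ‖x^k‖/k!`. -/
def constDelta (p : ℕ) : ℝ := ∑ k ∈ Finset.range p, ‖monomial k‖ / (k.factorial : ℝ)

end

end NumDiff

/-! Write φ for the weak derivative of order `p` of y. Taylor's formula gives y = Aφ + (Taylor
polynomial at 0), so the data fed to the scheme are Aφ + e, where e collects the noise and the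
errors in the initial values and ‖e‖ ≤ δ + Δ_p δ_i. If z is the Galerkin solution, then P_n A z =
P_n A φ + P_n e. Put x = z - P_n φ, which lies in X_n, ψ = φ - P_n φ, which has only high
frequencies, and h = P_n e. Then P_n A (x - ψ) = h, and everything rests on the stability estimate
‖x‖ ≤ c (n^p ‖h‖ + ‖ψ‖) with a single c below both C and γ. With ψ = h = 0 it shows that A_n is
injective, hence bijective, so the Moore–Penrose inverse is the true inverse. In general, ‖z - φ‖ ≤
‖x‖ + ‖ψ‖ and ‖ψ‖ ≤ n^{-l} ‖φ‖_{H^l_per} finish the proof.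

Stability is proved in Fourier coordinates. One integration divides the coefficients of index k by k
and exchanges sines and cosines, except that the mean of f enters every sine coefficient of `A 1 f`
(`fourierCos_A_one`, `fourierSin_A_one`). Undoing the p integrations therefore expresses the
coefficients of x through those of h and the p unknown means Z_j of A^j(x - ψ), j < p. These means
are tied together by a Parseval identity against the function x (`hasSum_fourierSin_div`). Split at
frequency n, it yields p linear equations for the Z_j, whose right-hand sides are controlled by h
(low part) and ψ (tail). After rescaling Z_j by n^{j+1/2} the coefficients are bounded uniformly in
n, and the system is invertible because π² > 8 (`solve_two`, `solve_three`; for p = 1 there is one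
equation, with coefficient π).

Taylor's formula comes from the du Bois-Reymond lemma of order p
(`eq_polynomial_of_integral_eq_zero`) and from the uniqueness of the continuous representative
(`fineRep_eqOn`). -/

namespace NumDiff

/-! ### Real Fourier coefficients and Parseval's identity. -/

theorem hasSum_of_eq {f g : ℕ → ℝ} {a b : ℝ} (h : HasSum f a) (hfg : ∀ k, f k = g k)
    (hab : a = b) : HasSum g b := by
  rwa [← funext hfg, ← hab]

theorem fourierCos_eq_inner (k : ℕ) (f : L2) : fourierCos k f = inner ℝ (basisCos k) f := by
  unfold fourierCos basisCos ofContinuous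
  rw [L2.inner_def, ← integral_const_mul]
  refine integral_congr_ae ?_
  filter_upwards [MemLp.coeFn_toLp (memLp_of_continuous (f := fun t : ℝ =>
    Real.cos (k * t) / √Real.pi) (by fun_prop))] with t ht
  rw [ht]
  simp only [RCLike.inner_apply, conj_trivial]
  ring

theorem fourierSin_eq_inner (k : ℕ) (f : L2) : fourierSin k f = inner ℝ (basisSin k) f := by
  unfold fourierSin basisSin ofContinuous
  rw [L2.inner_def, ← integral_const_mul]
  refine integral_congr_ae ?_
  filter_upwards [MemLp.coeFn_toLp (memLp_of_continuous (f := fun t : ℝ =>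
    Real.sin (k * t) / √Real.pi) (by fun_prop))] with t ht
  rw [ht]
  simp only [RCLike.inner_apply, conj_trivial]
  ring

theorem fourierCos_zero (f : L2) : fourierCos 0 f = 1 / √Real.pi * ∫ t, f t ∂μ := by
  simp [fourierCos]

theorem fourierSin_zero (f : L2) : fourierSin 0 f = 0 := by
  simp [fourierSin]

theorem basisConst_eq : basisConst = (1 / √2) • basisCos 0 := by
  unfold basisConst basisCos ofContinuous
  rw [← MemLp.toLp_const_smul]
  refine MemLp.toLp_congr _ _ (Filter.Eventually.of_forall fun t => ?_)
  simp only [Pi.smul_apply, smul_eq_mul, Nat.cast_zero, zero_mul, Real.cos_zero]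
  rw [Real.sqrt_mul (by norm_num)]
  field_simp

theorem fourierCos_add (k : ℕ) (f g : L2) :
    fourierCos k (f + g) = fourierCos k f + fourierCos k g := by
  simp only [fourierCos_eq_inner, inner_add_right]

theorem fourierSin_add (k : ℕ) (f g : L2) :
    fourierSin k (f + g) = fourierSin k f + fourierSin k g := by
  simp only [fourierSin_eq_inner, inner_add_right]

theorem fourierCos_sub (k : ℕ) (f g : L2) :
    fourierCos k (f - g) = fourierCos k f - fourierCos k g := by
  simp only [fourierCos_eq_inner, inner_sub_right]

theorem fourierSin_sub (k : ℕ) (f g : L2) :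
    fourierSin k (f - g) = fourierSin k f - fourierSin k g := by
  simp only [fourierSin_eq_inner, inner_sub_right]

theorem sq_norm_eq_integral (f : L2) : ‖f‖ ^ 2 = ∫ t, f t ^ 2 ∂μ := by
  rw [← real_inner_self_eq_norm_sq, L2.inner_def]
  refine integral_congr_ae (Filter.Eventually.of_forall fun t => ?_)
  simp only [RCLike.inner_apply, conj_trivial]
  ring

theorem integrable_mul_continuous (f : L2) {g : ℝ → ℝ} (hg : Continuous g) :
    Integrable (fun t => f t * g t) μ :=
  (Lp.memLp f).integrable_mul (memLp_of_continuous hg)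

theorem restrict_Ioc_eq : volume.restrict (Ioc 0 (2 * Real.pi)) = μ :=
  (Measure.restrict_congr_set Ioo_ae_eq_Ioc).symm

theorem integral_eq_interval (g : ℝ → ℝ) : ∫ t, g t ∂μ = ∫ t in (0 : ℝ)..(2 * Real.pi), g t := by
  rw [intervalIntegral.integral_of_le (by positivity), restrict_Ioc_eq]

/-- For real f the complex coefficients at k and -k are conjugate, with real and imaginary parts
proportional to the cosine and sine coefficients. This transfers the complex Parseval identity. -/
theorem sq_norm_fourierCoeffOn (f : L2) (k : ℕ) (n : ℤ) (hn : n = k ∨ n = -k) :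
    ‖fourierCoeffOn Real.two_pi_pos (fun t => (f t : ℂ)) n‖ ^ 2
      = (fourierCos k f ^ 2 + fourierSin k f ^ 2) / (4 * Real.pi) := by
  have hc : Integrable (fun t => f t * Real.cos (n * t)) μ :=
    integrable_mul_continuous f (by fun_prop)
  have hs : Integrable (fun t => f t * Real.sin (n * t)) μ :=
    integrable_mul_continuous f (by fun_prop)
  have key : fourierCoeffOn Real.two_pi_pos (fun t => (f t : ℂ)) n =
      ((1 / (2 * Real.pi) * ∫ t, f t * Real.cos (n * t) ∂μ : ℝ) : ℂ) +
      ((-(1 / (2 * Real.pi) * ∫ t, f t * Real.sin (n * t) ∂μ) : ℝ) : ℂ) * Complex.I := by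
    rw [fourierCoeffOn_eq_integral, intervalIntegral.integral_of_le (by positivity),
      restrict_Ioc_eq]
    have h1 : ∀ t : ℝ, (fourier (-n) (t : AddCircle (2 * Real.pi - 0))) • (f t : ℂ)
        = ((f t * Real.cos (n * t) : ℝ) : ℂ) - ((f t * Real.sin (n * t) : ℝ) : ℂ) * Complex.I := by
      intro t
      rw [fourier_coe_apply]
      have : 2 * (Real.pi : ℂ) * Complex.I * ((-n : ℤ) : ℂ) * t / ((2 * Real.pi - 0 : ℝ) : ℂ)
          = ((-(n * t) : ℝ) : ℂ) * Complex.I := by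
        have : (Real.pi : ℂ) ≠ 0 := by exact_mod_cast Real.pi_ne_zero
        push_cast
        field_simp
        ring
      rw [this, Complex.exp_mul_I, ← Complex.ofReal_cos, ← Complex.ofReal_sin, Real.cos_neg,
        Real.sin_neg, smul_eq_mul]
      push_cast
      ring
    simp_rw [h1]
    rw [integral_sub hc.ofReal (hs.ofReal.mul_const _), integral_mul_const,
      integral_complex_ofReal, integral_complex_ofReal, Complex.real_smul]
    push_cast
    ring
  rw [key, ← Complex.normSq_eq_norm_sq, Complex.normSq_add_mul_I]
  unfold fourierCos fourierSin
  have hp := Real.sq_sqrt Real.pi_pos.le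
  have e : ∀ A B : ℝ, (1 / (2 * Real.pi) * A) ^ 2 + (-(1 / (2 * Real.pi) * B)) ^ 2
      = ((1 / √Real.pi * A) ^ 2 + (1 / √Real.pi * B) ^ 2) / (4 * Real.pi) := by
    intro A B
    simp only [mul_pow, div_pow, neg_sq, hp]
    field_simp
    ring
  rcases hn with rfl | rfl
  · simpa using e _ _
  · have := e (∫ t, f t * Real.cos (k * t) ∂μ) (-∫ t, f t * Real.sin (k * t) ∂μ)
    simpa [integral_neg] using this

/-- The coefficient `fourierCos 0` carries the factor 1/√π instead of 1/√(2π), so it equals √2 ξ_0;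
hence the weight 1/2 on its square, here and below. -/
theorem hasSum_sq_fourier (f : L2) :
    HasSum (fun k : ℕ => fourierCos (k + 1) f ^ 2 + fourierSin (k + 1) f ^ 2)
      (‖f‖ ^ 2 - fourierCos 0 f ^ 2 / 2) := by
  have hL : MemLp (fun t => (f t : ℂ)) 2 (volume.restrict (Ioc 0 (2 * Real.pi))) := by
    rw [restrict_Ioc_eq]
    exact (Lp.memLp f).ofReal
  have h := (hasSum_sq_fourierCoeffOn Real.two_pi_pos hL).nat_add_neg
  have h2 : ∀ k : ℕ, ‖fourierCoeffOn Real.two_pi_pos (fun t => (f t : ℂ)) (k : ℤ)‖ ^ 2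
      + ‖fourierCoeffOn Real.two_pi_pos (fun t => (f t : ℂ)) (-(k : ℤ))‖ ^ 2
      = (fourierCos k f ^ 2 + fourierSin k f ^ 2) / (2 * Real.pi) := by
    intro k
    rw [sq_norm_fourierCoeffOn f k _ (Or.inl rfl), sq_norm_fourierCoeffOn f k _ (Or.inr rfl)]
    field_simp
    ring
  simp_rw [h2] at h
  rw [sq_norm_fourierCoeffOn f 0 0 (by simp), intervalIntegral.integral_of_le (by positivity),
    restrict_Ioc_eq] at h
  have h3 := h.mul_left (2 * Real.pi)
  -- Pairing n with -n counts the index 0 twice; removing the first term leaves minus one half of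
  -- its square.
  rw [← hasSum_nat_add_iff' 1] at h3
  refine hasSum_of_eq h3 (fun k => ?_) ?_
  · field_simp
  · rw [sq_norm_eq_integral]
    simp only [Complex.norm_real, Real.norm_eq_abs, sq_abs, fourierSin_zero, Finset.range_one,
      Finset.sum_singleton, smul_eq_mul, sub_zero]
    field_simp
    ring

/-- Polarization of the preceding identity. -/
theorem hasSum_mul_fourier (f g : L2) :
    HasSum (fun k : ℕ => fourierCos (k + 1) f * fourierCos (k + 1) g
        + fourierSin (k + 1) f * fourierSin (k + 1) g)
      (inner ℝ f g - fourierCos 0 f * fourierCos 0 g / 2) := by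
  have h := ((hasSum_sq_fourier (f + g)).sub
    ((hasSum_sq_fourier f).add (hasSum_sq_fourier g))).mul_left (1 / 2)
  have e1 : ∀ k : ℕ, 1 / 2 * (fourierCos (k + 1) (f + g) ^ 2 + fourierSin (k + 1) (f + g) ^ 2 -
      (fourierCos (k + 1) f ^ 2 + fourierSin (k + 1) f ^ 2 +
        (fourierCos (k + 1) g ^ 2 + fourierSin (k + 1) g ^ 2)))
      = fourierCos (k + 1) f * fourierCos (k + 1) g
        + fourierSin (k + 1) f * fourierSin (k + 1) g := by
    intro k
    rw [fourierCos_add, fourierSin_add]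
    ring
  have e2 : 1 / 2 * (‖f + g‖ ^ 2 - fourierCos 0 (f + g) ^ 2 / 2 -
      (‖f‖ ^ 2 - fourierCos 0 f ^ 2 / 2 + (‖g‖ ^ 2 - fourierCos 0 g ^ 2 / 2)))
      = inner ℝ f g - fourierCos 0 f * fourierCos 0 g / 2 := by
    rw [fourierCos_add, norm_add_sq_real]
    ring
  exact hasSum_of_eq h e1 e2

/-! ### Orthogonality and trigonometric polynomials. -/

theorem integral_cos_nat {m : ℕ} (hm : m ≠ 0) :
    ∫ t in (0 : ℝ)..(2 * Real.pi), Real.cos (m * t) = 0 := by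
  rw [intervalIntegral.integral_comp_mul_left (fun t => Real.cos t) (Nat.cast_ne_zero.mpr hm),
    integral_cos, mul_zero, Real.sin_zero, show (m : ℝ) * (2 * Real.pi) = ((2 * m : ℕ) : ℝ) * Real.pi by
      push_cast; ring, Real.sin_nat_mul_pi]
  simp

theorem integral_sin_nat (m : ℕ) :
    ∫ t in (0 : ℝ)..(2 * Real.pi), Real.sin (m * t) = 0 := by
  rcases eq_or_ne m 0 with rfl | hm
  · simp
  rw [intervalIntegral.integral_comp_mul_left (fun t => Real.sin t) (Nat.cast_ne_zero.mpr hm),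
    integral_sin, mul_zero, Real.cos_zero, Real.cos_nat_mul_two_pi]
  simp

theorem integral_cos_mul_cos {j k : ℕ} (h : j < k) :
    ∫ t, Real.cos (j * t) * Real.cos (k * t) ∂μ = 0 := by
  obtain ⟨d, rfl⟩ := Nat.exists_eq_add_of_lt h
  have e : ∀ t : ℝ, Real.cos (j * t) * Real.cos ((j + d + 1 : ℕ) * t)
      = (Real.cos ((2 * j + d + 1 : ℕ) * t) + Real.cos ((d + 1 : ℕ) * t)) / 2 := by
    intro t
    have h1 : ((2 * j + d + 1 : ℕ) : ℝ) * t = (j + d + 1 : ℕ) * t + j * t := by push_cast; ring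
    have h2 : ((d + 1 : ℕ) : ℝ) * t = (j + d + 1 : ℕ) * t - j * t := by push_cast; ring
    rw [h1, h2, Real.cos_add, Real.cos_sub]
    ring
  simp_rw [e]
  rw [integral_eq_interval, intervalIntegral.integral_div, intervalIntegral.integral_add
    (by apply Continuous.intervalIntegrable; fun_prop)
    (by apply Continuous.intervalIntegrable; fun_prop),
    integral_cos_nat (by omega), integral_cos_nat (by omega)]
  simp

theorem integral_sin_mul_sin {j k : ℕ} (h : j < k) :
    ∫ t, Real.sin (j * t) * Real.sin (k * t) ∂μ = 0 := by
  obtain ⟨d, rfl⟩ := Nat.exists_eq_add_of_lt h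
  have e : ∀ t : ℝ, Real.sin (j * t) * Real.sin ((j + d + 1 : ℕ) * t)
      = (Real.cos ((d + 1 : ℕ) * t) - Real.cos ((2 * j + d + 1 : ℕ) * t)) / 2 := by
    intro t
    have h1 : ((2 * j + d + 1 : ℕ) : ℝ) * t = (j + d + 1 : ℕ) * t + j * t := by push_cast; ring
    have h2 : ((d + 1 : ℕ) : ℝ) * t = (j + d + 1 : ℕ) * t - j * t := by push_cast; ring
    rw [h1, h2, Real.cos_add, Real.cos_sub]
    ring
  simp_rw [e]
  rw [integral_eq_interval, intervalIntegral.integral_div, intervalIntegral.integral_sub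
    (by apply Continuous.intervalIntegrable; fun_prop)
    (by apply Continuous.intervalIntegrable; fun_prop),
    integral_cos_nat (by omega), integral_cos_nat (by omega)]
  simp

theorem integral_cos_mul_sin {j k : ℕ} :
    ∫ t, Real.cos (j * t) * Real.sin (k * t) ∂μ = 0 := by
  have hp : ∀ m n : ℕ, ∫ t in (0 : ℝ)..(2 * Real.pi),
      (Real.sin (m * t) + Real.sin (n * t)) / 2 = 0 := by
    intro m n
    rw [intervalIntegral.integral_div, intervalIntegral.integral_add
      (by apply Continuous.intervalIntegrable; fun_prop)
      (by apply Continuous.intervalIntegrable; fun_prop), integral_sin_nat, integral_sin_nat]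
    simp
  have hm : ∀ m n : ℕ, ∫ t in (0 : ℝ)..(2 * Real.pi),
      (Real.sin (m * t) - Real.sin (n * t)) / 2 = 0 := by
    intro m n
    rw [intervalIntegral.integral_div, intervalIntegral.integral_sub
      (by apply Continuous.intervalIntegrable; fun_prop)
      (by apply Continuous.intervalIntegrable; fun_prop), integral_sin_nat, integral_sin_nat]
    simp
  rw [integral_eq_interval]
  rcases le_total j k with h | h
  · obtain ⟨d, rfl⟩ := Nat.exists_eq_add_of_le h
    refine Eq.trans (intervalIntegral.integral_congr fun t _ => ?_) (hp (2 * j + d) d)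
    have h1 : ((2 * j + d : ℕ) : ℝ) * t = (j + d : ℕ) * t + j * t := by push_cast; ring
    have h2 : (d : ℝ) * t = (j + d : ℕ) * t - j * t := by push_cast; ring
    rw [h1, h2, Real.sin_add, Real.sin_sub]
    ring
  · obtain ⟨d, rfl⟩ := Nat.exists_eq_add_of_le h
    refine Eq.trans (intervalIntegral.integral_congr fun t _ => ?_) (hm (2 * k + d) d)
    have h1 : ((2 * k + d : ℕ) : ℝ) * t = (k + d : ℕ) * t + k * t := by push_cast; ring
    have h2 : (d : ℝ) * t = (k + d : ℕ) * t - k * t := by push_cast; ring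
    rw [h1, h2, Real.sin_add, Real.sin_sub]
    ring

theorem fourierCos_ofContinuous (k : ℕ) (f : ℝ → ℝ) (hf : Continuous f) :
    fourierCos k (ofContinuous f hf) = 1 / √Real.pi * ∫ t, f t * Real.cos (k * t) ∂μ := by
  unfold fourierCos ofContinuous
  congr 1
  refine integral_congr_ae ?_
  filter_upwards [MemLp.coeFn_toLp (memLp_of_continuous hf)] with t ht
  rw [ht]

theorem fourierSin_ofContinuous (k : ℕ) (f : ℝ → ℝ) (hf : Continuous f) :
    fourierSin k (ofContinuous f hf) = 1 / √Real.pi * ∫ t, f t * Real.sin (k * t) ∂μ := by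
  unfold fourierSin ofContinuous
  congr 1
  refine integral_congr_ae ?_
  filter_upwards [MemLp.coeFn_toLp (memLp_of_continuous hf)] with t ht
  rw [ht]

theorem fourierCos_basisCos {j k : ℕ} (h : j < k) : fourierCos k (basisCos j) = 0 := by
  unfold basisCos
  rw [fourierCos_ofContinuous]
  simp_rw [div_mul_eq_mul_div]
  rw [integral_div, integral_cos_mul_cos h]
  simp

theorem fourierSin_basisCos (j k : ℕ) : fourierSin k (basisCos j) = 0 := by
  unfold basisCos
  rw [fourierSin_ofContinuous]
  simp_rw [div_mul_eq_mul_div]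
  rw [integral_div, integral_cos_mul_sin]
  simp

theorem fourierCos_basisSin (j k : ℕ) : fourierCos k (basisSin j) = 0 := by
  rw [fourierCos_eq_inner, real_inner_comm, ← fourierSin_eq_inner, fourierSin_basisCos]

theorem fourierSin_basisSin {j k : ℕ} (h : j < k) : fourierSin k (basisSin j) = 0 := by
  unfold basisSin
  rw [fourierSin_ofContinuous]
  simp_rw [div_mul_eq_mul_div]
  rw [integral_div, integral_sin_mul_sin h]
  simp

theorem basisCos_mem_X {n k : ℕ} (hk : k ≤ n) : basisCos k ∈ X n := by
  rcases Nat.eq_zero_or_pos k with rfl | h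
  · have h2 : basisCos 0 = √2 • basisConst := by
      rw [basisConst_eq, smul_smul, mul_one_div_cancel (by positivity), one_smul]
    rw [h2]
    exact Submodule.smul_mem _ _ (Submodule.subset_span (Or.inl (Or.inl rfl)))
  · exact Submodule.subset_span (Or.inl (Or.inr ⟨k, ⟨h, hk⟩, rfl⟩))

theorem basisSin_mem_X {n k : ℕ} (h : 1 ≤ k) (hk : k ≤ n) : basisSin k ∈ X n :=
  Submodule.subset_span (Or.inr ⟨k, ⟨h, hk⟩, rfl⟩)

/-- The coefficients of high frequency of a trigonometric polynomial vanish. -/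
theorem fourier_eq_zero_of_mem_X {n k : ℕ} (hk : n < k) {f : L2} (hf : f ∈ X n) :
    fourierCos k f = 0 ∧ fourierSin k f = 0 := by
  have h : X n ≤ (Submodule.span ℝ {basisCos k, basisSin k})ᗮ := by
    refine Submodule.span_le.mpr fun g hg => ?_
    rw [SetLike.mem_coe, Submodule.mem_orthogonal]
    have hg' : fourierCos k g = 0 ∧ fourierSin k g = 0 := by
      rcases hg with (hg | ⟨j, hj, rfl⟩) | ⟨j, hj, rfl⟩
      · rw [mem_singleton_iff] at hg
        rw [hg, basisConst_eq, fourierCos_eq_inner, fourierSin_eq_inner, inner_smul_right,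
          inner_smul_right, ← fourierCos_eq_inner, ← fourierSin_eq_inner,
          fourierCos_basisCos (by omega), fourierSin_basisCos]
        simp
      · exact ⟨fourierCos_basisCos (lt_of_le_of_lt hj.2 hk), fourierSin_basisCos j k⟩
      · exact ⟨fourierCos_basisSin j k, fourierSin_basisSin (lt_of_le_of_lt hj.2 hk)⟩
    intro u hu
    obtain ⟨a, b, rfl⟩ := Submodule.mem_span_pair.mp hu
    rw [inner_add_left, inner_smul_left, inner_smul_left, ← fourierCos_eq_inner,
      ← fourierSin_eq_inner, hg'.1, hg'.2]
    simp
  have h2 := (Submodule.mem_orthogonal _ _).mp (h hf)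
  rw [fourierCos_eq_inner, fourierSin_eq_inner]
  exact ⟨h2 _ (Submodule.subset_span (by simp)), h2 _ (Submodule.subset_span (by simp))⟩

theorem fourierCos_P {n k : ℕ} (hk : k ≤ n) (f : L2) :
    fourierCos k (P n f : L2) = fourierCos k f := by
  rw [fourierCos_eq_inner, fourierCos_eq_inner]
  exact (X n).inner_orthogonalProjectionOnto_eq_of_mem_left ⟨_, basisCos_mem_X hk⟩ f

theorem fourierSin_P {n k : ℕ} (hk : k ≤ n) (f : L2) :
    fourierSin k (P n f : L2) = fourierSin k f := by
  rcases Nat.eq_zero_or_pos k with rfl | h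
  · rw [fourierSin_zero, fourierSin_zero]
  rw [fourierSin_eq_inner, fourierSin_eq_inner]
  exact (X n).inner_orthogonalProjectionOnto_eq_of_mem_left ⟨_, basisSin_mem_X h hk⟩ f

theorem sq_norm_of_mem_X {n : ℕ} {f : L2} (hf : f ∈ X n) :
    ‖f‖ ^ 2 = fourierCos 0 f ^ 2 / 2
      + ∑ k ∈ Finset.range n, fourierCos (k + 1) f ^ 2
      + ∑ k ∈ Finset.range n, fourierSin (k + 1) f ^ 2 := by
  have h := (hasSum_sq_fourier f).unique (hasSum_sum_of_ne_finset_zero (s := Finset.range n) ?_)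
  · rw [Finset.sum_add_distrib] at h
    linarith
  · intro k hk
    rw [Finset.mem_range, not_lt] at hk
    obtain ⟨h1, h2⟩ := fourier_eq_zero_of_mem_X (show n < k + 1 by omega) hf
    rw [h1, h2]
    simp

/-- The squared norm of a function without low frequencies. -/
theorem hasSum_sq_tail {n : ℕ} {f : L2} (hc : ∀ k ≤ n, fourierCos k f = 0)
    (hs : ∀ k ≤ n, fourierSin k f = 0) :
    HasSum (fun i : ℕ => fourierCos (i + n + 1) f ^ 2 + fourierSin (i + n + 1) f ^ 2)
      (‖f‖ ^ 2) := by
  have h := (hasSum_nat_add_iff' n).mpr (hasSum_sq_fourier f)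
  rw [hc 0 (by omega), Finset.sum_eq_zero] at h
  · simpa using h
  · intro k hk
    rw [Finset.mem_range] at hk
    rw [hc _ (by omega), hs _ (by omega)]
    simp

/-! ### Integration in Fourier coordinates. -/

/-- Fubini's theorem on the triangle `0 < s ≤ t ≤ x`. -/
theorem integral_primitive_mul {f g : ℝ → ℝ} {x : ℝ} (hx : 0 ≤ x)
    (hf : IntervalIntegrable f volume 0 x) (hg : Continuous g) :
    ∫ t in (0 : ℝ)..x, (∫ s in (0 : ℝ)..t, f s) * g t
      = ∫ s in (0 : ℝ)..x, f s * ∫ t in s..x, g t := by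
  have hf' : Integrable f (volume.restrict (Ioc 0 x)) :=
    (intervalIntegrable_iff_integrableOn_Ioc_of_le hx).1 hf
  have hg' : Integrable g (volume.restrict (Ioc 0 x)) :=
    (intervalIntegrable_iff_integrableOn_Ioc_of_le hx).1 (hg.intervalIntegrable 0 x)
  have hS : MeasurableSet {z : ℝ × ℝ | z.2 ≤ z.1} := measurableSet_le measurable_snd measurable_fst
  have hint := (hg'.mul_prod hf').indicator hS
  rw [intervalIntegral.integral_of_le hx, intervalIntegral.integral_of_le hx]
  have h1 : ∀ t ∈ Ioc 0 x, (∫ s in (0 : ℝ)..t, f s) * g t =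
      ∫ s in Ioc 0 x, {z : ℝ × ℝ | z.2 ≤ z.1}.indicator (fun z => g z.1 * f z.2) (t, s) := by
    intro t ht
    have e : ∀ s, {z : ℝ × ℝ | z.2 ≤ z.1}.indicator (fun z => g z.1 * f z.2) (t, s)
        = (Iic t).indicator (fun s => g t * f s) s := by
      intro s
      by_cases h : s ≤ t <;> simp [indicator, h]
    simp_rw [e]
    rw [setIntegral_indicator measurableSet_Iic, intervalIntegral.integral_of_le ht.1.le,
      Ioc_inter_Iic, min_eq_right ht.2, integral_const_mul, mul_comm]
  have h2 : ∀ s ∈ Ioc 0 x, f s * (∫ t in s..x, g t) =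
      ∫ t in Ioc 0 x, {z : ℝ × ℝ | z.2 ≤ z.1}.indicator (fun z => g z.1 * f z.2) (t, s) := by
    intro s hs
    have e : ∀ t, {z : ℝ × ℝ | z.2 ≤ z.1}.indicator (fun z => g z.1 * f z.2) (t, s)
        = (Ici s).indicator (fun t => f s * g t) t := by
      intro t
      by_cases h : s ≤ t <;> simp [indicator, h, mul_comm]
    simp_rw [e]
    have e2 : Ioc 0 x ∩ Ici s = Icc s x := by
      ext t
      simp only [mem_inter_iff, mem_Ioc, mem_Ici, mem_Icc]
      exact ⟨fun h => ⟨h.2, h.1.2⟩, fun h => ⟨⟨hs.1.trans_le h.1, h.2⟩, h.1⟩⟩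
    rw [setIntegral_indicator measurableSet_Ici, intervalIntegral.integral_of_le hs.2, e2,
      integral_const_mul, integral_Icc_eq_integral_Ioc]
  rw [setIntegral_congr_fun measurableSet_Ioc h1, setIntegral_congr_fun measurableSet_Ioc h2]
  exact integral_integral_swap hint

theorem intervalIntegrable_coe (φ : L2) {x : ℝ} (hx : x ∈ Icc 0 (2 * Real.pi)) :
    IntervalIntegrable φ volume 0 x := by
  rw [intervalIntegrable_iff_integrableOn_Ioo_of_le hx.1]
  exact IntegrableOn.mono_set (t := Ioo 0 (2 * Real.pi)) (integrable_coe φ)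
    (Ioo_subset_Ioo_right hx.2)

theorem ae_mem : ∀ᵐ x ∂μ, x ∈ Ioo 0 (2 * Real.pi) := ae_restrict_mem measurableSet_Ioo

theorem coeFn_A (p : ℕ) (φ : L2) : A p φ =ᵐ[μ] integralFun p φ :=
  MemLp.coeFn_toLp (memLp_integralFun p φ)

theorem integralFun_one (φ : L2) (x : ℝ) : integralFun 1 φ x = ∫ t in (0 : ℝ)..x, φ t := by
  simp [integralFun]

theorem interval_integral_congr_ae {f g : ℝ → ℝ} (h : f =ᵐ[μ] g) {x : ℝ}
    (hx : x ∈ Icc 0 (2 * Real.pi)) : ∫ t in (0 : ℝ)..x, f t = ∫ t in (0 : ℝ)..x, g t := by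
  rw [intervalIntegral.integral_of_le hx.1, intervalIntegral.integral_of_le hx.1,
    integral_Ioc_eq_integral_Ioo, integral_Ioc_eq_integral_Ioo]
  exact integral_congr_ae (ae_restrict_of_ae_restrict_of_subset (Ioo_subset_Ioo_right hx.2) h)

theorem integral_A_one_mul (f : L2) {g : ℝ → ℝ} (hg : Continuous g) :
    ∫ t, A 1 f t * g t ∂μ = ∫ s, f s * (∫ t in s..(2 * Real.pi), g t) ∂μ := by
  have h : (fun t => A 1 f t * g t) =ᵐ[μ] fun t => (∫ s in (0 : ℝ)..t, f s) * g t := by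
    filter_upwards [coeFn_A 1 f] with t ht
    rw [ht, integralFun_one]
  rw [integral_congr_ae h, integral_eq_interval, integral_eq_interval,
    integral_primitive_mul (by positivity)
      (intervalIntegrable_coe f ⟨by positivity, le_rfl⟩) hg]

/-- Cauchy's formula for repeated integration: exchanging the integrals turns the kernel (x - t)^p
into (x - s)^{p+1}/(p+1). -/
theorem A_succ_succ (p : ℕ) (f : L2) : A (p + 2) f = A (p + 1) (A 1 f) := by
  refine MemLp.toLp_congr (memLp_integralFun _ _) (memLp_integralFun _ _) ?_
  filter_upwards [ae_mem] with x hx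
  have hx' := Ioo_subset_Icc_self hx
  unfold integralFun
  have h : (fun t => (x - t) ^ p * A 1 f t) =ᵐ[μ]
      fun t => (∫ s in (0 : ℝ)..t, f s) * (x - t) ^ p := by
    filter_upwards [coeFn_A 1 f] with t ht
    rw [ht, integralFun_one, mul_comm]
  simp only [Nat.add_sub_cancel, show p + 2 - 1 = p + 1 from rfl]
  rw [interval_integral_congr_ae h hx',
    integral_primitive_mul hx'.1 (intervalIntegrable_coe f hx') (by fun_prop)]
  have e : ∀ s, f s * ∫ t in s..x, (x - t) ^ p
      = (1 / ((p : ℝ) + 1)) * ((x - s) ^ (p + 1) * f s) := by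
    intro s
    rw [intervalIntegral.integral_comp_sub_left (fun t => t ^ p) x, integral_pow]
    have : (p : ℝ) + 1 ≠ 0 := by positivity
    field_simp
    simp
  simp_rw [e]
  rw [intervalIntegral.integral_const_mul, Nat.factorial_succ]
  have : (p : ℝ) + 1 ≠ 0 := by positivity
  push_cast
  field_simp

theorem A_two (f : L2) : A 2 f = A 1 (A 1 f) := A_succ_succ 0 f

theorem A_three (f : L2) : A 3 f = A 1 (A 1 (A 1 f)) := by
  rw [A_succ_succ 1 f, A_succ_succ 0]

/-- After Fubini, the cosine is replaced by its integral from s to 2π, a multiple of sin; the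
boundary term at 2π vanishes. For the sine, in the next lemma, the boundary term is cos(2πk) = 1,
which produces the mean of f. -/
theorem fourierCos_A_one (k : ℕ) (f : L2) :
    fourierCos (k + 1) (A 1 f) = -fourierSin (k + 1) f / ((k : ℝ) + 1) := by
  have hk : (k : ℝ) + 1 ≠ 0 := by positivity
  unfold fourierCos fourierSin
  rw [integral_A_one_mul f (by fun_prop)]
  have e : ∀ s, f s * (∫ t in s..(2 * Real.pi), Real.cos ((k + 1 : ℕ) * t))
      = (-1 / ((k : ℝ) + 1)) * (f s * Real.sin ((k + 1 : ℕ) * s)) := by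
    intro s
    have hk' : ((k + 1 : ℕ) : ℝ) ≠ 0 := by positivity
    rw [intervalIntegral.integral_comp_mul_left (fun t => Real.cos t) hk', integral_cos,
      show ((k + 1 : ℕ) : ℝ) * (2 * Real.pi) = ((2 * (k + 1) : ℕ) : ℝ) * Real.pi by
        push_cast; ring, Real.sin_nat_mul_pi]
    push_cast
    simp only [smul_eq_mul]
    field_simp
    ring
  simp_rw [e]
  rw [integral_const_mul]
  ring

theorem fourierSin_A_one (k : ℕ) (f : L2) :
    fourierSin (k + 1) (A 1 f) = (fourierCos (k + 1) f - fourierCos 0 f) / ((k : ℝ) + 1) := by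
  have hk : (k : ℝ) + 1 ≠ 0 := by positivity
  rw [fourierCos_zero]
  unfold fourierCos fourierSin
  rw [integral_A_one_mul f (by fun_prop)]
  have e : ∀ s, f s * (∫ t in s..(2 * Real.pi), Real.sin ((k + 1 : ℕ) * t))
      = (1 / ((k : ℝ) + 1)) * (f s * Real.cos ((k + 1 : ℕ) * s) - f s) := by
    intro s
    have hk' : ((k + 1 : ℕ) : ℝ) ≠ 0 := by positivity
    rw [intervalIntegral.integral_comp_mul_left (fun t => Real.sin t) hk', integral_sin,
      Real.cos_nat_mul_two_pi]
    push_cast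
    simp only [smul_eq_mul]
    field_simp
  simp_rw [e]
  rw [integral_const_mul, integral_sub (integrable_mul_continuous f (by fun_prop))
    (integrable_coe f)]
  ring

theorem coeFn_monomial (k : ℕ) : monomial k =ᵐ[μ] fun x => x ^ k :=
  MemLp.coeFn_toLp (memLp_of_continuous (continuous_pow k))

theorem integral_mu_one : ∫ _t, (1 : ℝ) ∂μ = 2 * Real.pi := by
  rw [integral_eq_interval]
  simp

theorem A_one_monomial_zero : A 1 (monomial 0) = monomial 1 := by
  refine MemLp.toLp_congr (memLp_integralFun _ _) (memLp_of_continuous (continuous_pow 1)) ?_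
  filter_upwards [ae_mem] with x hx
  rw [integralFun_one, interval_integral_congr_ae (coeFn_monomial 0) (Ioo_subset_Icc_self hx)]
  simp

theorem fourier_monomial_zero (k : ℕ) :
    fourierCos (k + 1) (monomial 0) = 0 ∧ fourierSin (k + 1) (monomial 0) = 0 := by
  unfold monomial
  rw [fourierCos_ofContinuous, fourierSin_ofContinuous, integral_eq_interval, integral_eq_interval]
  simp only [pow_zero, one_mul]
  rw [integral_cos_nat (by omega), integral_sin_nat]
  simp

/-- Parseval's identity for f against the function x. Since x is the primitive of 1, its
coefficients come from the two preceding formulas: the cosine ones vanish for k ≥ 1 and the sine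
ones are -2√π/k. The mean of `A 1 f` enters because it is, by Fubini, an integral of f(s)(2π - s).
-/
theorem hasSum_fourierSin_div (f : L2) :
    HasSum (fun k : ℕ => fourierSin (k + 1) f / ((k : ℝ) + 1))
      ((fourierCos 0 (A 1 f) - Real.pi * fourierCos 0 f) / 2) := by
  have hp : √Real.pi ≠ 0 := by positivity
  have hp2 := Real.mul_self_sqrt Real.pi_pos.le
  have hZ : fourierCos 0 (monomial 0) = 2 * √Real.pi := by
    rw [fourierCos_zero, integral_congr_ae (coeFn_monomial 0)]
    simp only [pow_zero]
    rw [integral_mu_one]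
    field_simp
    linarith
  have hZ1 : fourierCos 0 (monomial 1) = 2 * √Real.pi * Real.pi := by
    rw [fourierCos_zero, integral_congr_ae (coeFn_monomial 1), integral_eq_interval]
    simp only [pow_one]
    rw [integral_id]
    field_simp
    linear_combination (-4) * Real.pi * hp2
  have hI : inner ℝ f (monomial 1) = ∫ t, f t * t ∂μ := by
    rw [L2.inner_def]
    refine integral_congr_ae ?_
    filter_upwards [coeFn_monomial 1] with t ht
    rw [ht]
    simp [mul_comm]
  have hA : fourierCos 0 (A 1 f) = 2 * Real.pi * fourierCos 0 f
      - 1 / √Real.pi * ∫ t, f t * t ∂μ := by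
    have h := integral_A_one_mul f (g := fun _ => 1) continuous_const
    simp only [mul_one, intervalIntegral.integral_const, smul_eq_mul] at h
    rw [fourierCos_zero, fourierCos_zero, h]
    simp_rw [mul_sub]
    rw [integral_sub ((integrable_coe f).mul_const _)
      (integrable_mul_continuous f (g := fun s => s) continuous_id),
      integral_mul_const]
    ring
  have h := (hasSum_mul_fourier f (monomial 1)).mul_left (-1 / (2 * √Real.pi))
  refine hasSum_of_eq h (fun k => ?_) ?_
  · rw [← A_one_monomial_zero, fourierCos_A_one, fourierSin_A_one, (fourier_monomial_zero k).1,
      (fourier_monomial_zero k).2, hZ]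
    field_simp
    ring
  · rw [hI, hA, hZ1]
    field_simp
    ring

/-! ### Tails and weighted sums. -/

/-- Telescoping: 1/k² ≤ 1/(k - 1/2) - 1/(k + 1/2). The resulting bound 2/(2n+1), sharper than 1/n,
gives q t ≤ 4 in `scaled_bounds`. -/
theorem sum_range_inv_sq_le (n N : ℕ) :
    ∑ i ∈ Finset.range N, 1 / (((i + n : ℕ) : ℝ) + 1) ^ 2
      ≤ 2 / (2 * (n : ℝ) + 1) - 2 / (2 * ((n : ℝ) + N) + 1) := by
  induction N with
  | zero => simp
  | succ N ih =>
    rw [Finset.sum_range_succ]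
    have h : 1 / (((N + n : ℕ) : ℝ) + 1) ^ 2
        ≤ 2 / (2 * ((n : ℝ) + N) + 1) - 2 / (2 * ((n : ℝ) + (N + 1 : ℕ)) + 1) := by
      push_cast
      rw [div_sub_div _ _ (by positivity) (by positivity), div_le_div_iff₀ (by positivity)
        (by positivity)]
      nlinarith
    linarith

theorem summable_inv_sq_tail (n : ℕ) :
    Summable fun i : ℕ => 1 / (((i + n : ℕ) : ℝ) + 1) ^ 2 :=
  summable_of_sum_range_le (c := 2 / (2 * (n : ℝ) + 1)) (fun i => by positivity) fun N =>
    (sum_range_inv_sq_le n N).trans (sub_le_self _ (by positivity))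

theorem tsum_inv_sq_tail_le (n : ℕ) :
    ∑' i : ℕ, 1 / (((i + n : ℕ) : ℝ) + 1) ^ 2 ≤ 2 / (2 * (n : ℝ) + 1) :=
  Real.tsum_le_of_sum_range_le (fun i => by positivity) fun N =>
    (sum_range_inv_sq_le n N).trans (sub_le_self _ (by positivity))

/-- Cauchy–Schwarz for the tail of a weighted series. -/
theorem tail_weighted_le {n : ℕ} (hn : 1 ≤ n) {r : ℝ} (hr : 0 < r) (hrn : r ^ 2 = n) {c : ℕ → ℝ}
    {M : ℝ} (hM : 0 ≤ M) (hc : ∀ N, ∑ i ∈ Finset.range N, c i ^ 2 ≤ M ^ 2) (j : ℕ) :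
    Summable (fun i => c i / (((i + n : ℕ) : ℝ) + 1) ^ (j + 1)) ∧
      |∑' i, c i / (((i + n : ℕ) : ℝ) + 1) ^ (j + 1)| ≤ M / r ^ (2 * j + 1) := by
  have hn' : (1 : ℝ) ≤ n := by exact_mod_cast hn
  have hT : ∀ N, ∑ i ∈ Finset.range N, (1 / (((i + n : ℕ) : ℝ) + 1)) ^ 2 ≤ (1 / r) ^ 2 := by
    intro N
    simp_rw [div_pow, one_pow]
    refine (sum_range_inv_sq_le n N).trans ((sub_le_self _ (by positivity)).trans ?_)
    rw [hrn, div_le_div_iff₀ (by positivity) (by positivity)]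
    linarith
  have hb : ∀ N, ∑ i ∈ Finset.range N, |c i / (((i + n : ℕ) : ℝ) + 1) ^ (j + 1)|
      ≤ M / r ^ (2 * j + 1) := by
    intro N
    -- All but one of the powers of 1/k are bounded by 1/n = 1/r²; the last is kept for
    -- Cauchy–Schwarz.
    have h1 : ∑ i ∈ Finset.range N, |c i / (((i + n : ℕ) : ℝ) + 1) ^ (j + 1)|
        ≤ ∑ i ∈ Finset.range N, 1 / r ^ (2 * j) * (|c i| * (1 / (((i + n : ℕ) : ℝ) + 1))) := by
      refine Finset.sum_le_sum fun i _ => ?_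
      have hK : r ^ 2 ≤ ((i + n : ℕ) : ℝ) + 1 := by
        rw [hrn]
        push_cast
        have : (0 : ℝ) ≤ i := Nat.cast_nonneg i
        linarith
      have hK0 : (0 : ℝ) < ((i + n : ℕ) : ℝ) + 1 := by positivity
      rw [abs_div, abs_of_pos (pow_pos hK0 _), pow_succ]
      have h2 : 1 / (((i + n : ℕ) : ℝ) + 1) ^ j ≤ 1 / r ^ (2 * j) := by
        rw [pow_mul]
        exact one_div_le_one_div_of_le (by positivity) (pow_le_pow_left₀ (by positivity) hK j)
      calc |c i| / ((((i + n : ℕ) : ℝ) + 1) ^ j * (((i + n : ℕ) : ℝ) + 1))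
          = 1 / (((i + n : ℕ) : ℝ) + 1) ^ j * (|c i| * (1 / (((i + n : ℕ) : ℝ) + 1))) := by
            field_simp
        _ ≤ _ := mul_le_mul_of_nonneg_right h2 (by positivity)
    have h3 : ∑ i ∈ Finset.range N, |c i| * (1 / (((i + n : ℕ) : ℝ) + 1)) ≤ M * (1 / r) := by
      refine abs_le_of_sq_le_sq' ?_ (by positivity) |>.2
      refine (Finset.sum_mul_sq_le_sq_mul_sq _ _ _).trans ?_
      rw [mul_pow]
      simp_rw [sq_abs]
      exact mul_le_mul (hc N) (hT N) (Finset.sum_nonneg fun i _ => sq_nonneg _) (sq_nonneg _)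
    rw [← Finset.mul_sum] at h1
    refine h1.trans ((mul_le_mul_of_nonneg_left h3 (by positivity)).trans (le_of_eq ?_))
    rw [pow_succ]
    field_simp
  have hs := summable_of_sum_range_le (fun i => abs_nonneg _) hb
  refine ⟨hs.of_abs, ?_⟩
  refine le_trans ?_ (Real.tsum_le_of_sum_range_le (fun i => abs_nonneg _) hb)
  simpa only [Real.norm_eq_abs] using
    norm_tsum_le_tsum_norm (f := fun i => c i / (((i + n : ℕ) : ℝ) + 1) ^ (j + 1))
      (by simpa only [Real.norm_eq_abs] using hs)

theorem sum_weighted_sq_le (n j : ℕ) (c : ℕ → ℝ) :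
    ∑ k ∈ Finset.range n, (((k : ℝ) + 1) ^ j * c k) ^ 2
      ≤ (n : ℝ) ^ (2 * j) * ∑ k ∈ Finset.range n, c k ^ 2 := by
  rw [Finset.mul_sum]
  refine Finset.sum_le_sum fun k hk => ?_
  rw [mul_pow, ← pow_mul, mul_comm j 2]
  refine mul_le_mul_of_nonneg_right (pow_le_pow_left₀ (by positivity) ?_ _) (sq_nonneg _)
  exact_mod_cast Finset.mem_range.mp hk

theorem sum_weights_sq_le (n j : ℕ) :
    ∑ k ∈ Finset.range n, (((k : ℝ) + 1) ^ j) ^ 2 ≤ (n : ℝ) ^ (2 * j + 1) := by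
  have h := sum_weighted_sq_le n j fun _ => 1
  simpa [pow_succ] using h

theorem sq_sum_weighted_le (n j : ℕ) (c : ℕ → ℝ) :
    (∑ k ∈ Finset.range n, ((k : ℝ) + 1) ^ j * c k) ^ 2
      ≤ (n : ℝ) ^ (2 * j + 1) * ∑ k ∈ Finset.range n, c k ^ 2 :=
  (Finset.sum_mul_sq_le_sq_mul_sq _ _ _).trans
    (mul_le_mul_of_nonneg_right (sum_weights_sq_le n j) (Finset.sum_nonneg fun _ _ => sq_nonneg _))

theorem abs_sum_weighted_le {n : ℕ} {r : ℝ} (hr : 0 < r) (hrn : r ^ 2 = n) {c : ℕ → ℝ} {N : ℝ}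
    (hN : 0 ≤ N) (hc : ∑ k ∈ Finset.range n, c k ^ 2 ≤ N ^ 2) (j : ℕ) :
    |∑ k ∈ Finset.range n, ((k : ℝ) + 1) ^ j * c k| ≤ r ^ (2 * j + 1) * N := by
  refine abs_le_of_sq_le_sq ?_ (by positivity)
  refine (sq_sum_weighted_le n j c).trans ?_
  rw [← hrn, mul_pow, ← pow_mul, ← pow_mul, mul_comm 2]
  exact mul_le_mul_of_nonneg_left hc (by positivity)

/-- The splitting of `hasSum_fourierSin_div` at frequency `n`. -/
theorem fourierCos_zero_A_one_split (n : ℕ) (f : L2) :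
    (fourierCos 0 (A 1 f) - Real.pi * fourierCos 0 f) / 2
      = ∑ k ∈ Finset.range n, fourierSin (k + 1) f / ((k : ℝ) + 1)
        + ∑' i : ℕ, fourierSin (i + n + 1) f / (((i + n : ℕ) : ℝ) + 1) := by
  have h := hasSum_fourierSin_div f
  rw [← h.tsum_eq, ← h.summable.sum_add_tsum_nat_add n]

/-! ### The Galerkin equation and stability for p = 1. -/

/-- `h` has the low frequencies of `A^{(p)} (x - ψ)`, where `x` and `h` are trigonometric
polynomials and `ψ` has no low frequencies. -/
structure GalerkinEq (p n : ℕ) (x ψ h : L2) : Prop where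
  x_mem : x ∈ X n
  h_mem : h ∈ X n
  cos_ψ : ∀ k ≤ n, fourierCos k ψ = 0
  sin_ψ : ∀ k ≤ n, fourierSin k ψ = 0
  cos_h : ∀ k ≤ n, fourierCos k h = fourierCos k (A p (x - ψ))
  sin_h : ∀ k ≤ n, fourierSin k h = fourierSin k (A p (x - ψ))

namespace GalerkinEq

variable {p n : ℕ} {x ψ h : L2}

theorem cos_x (H : GalerkinEq p n x ψ h) {k : ℕ} (hk : k ≤ n) :
    fourierCos k (x - ψ) = fourierCos k x := by
  rw [fourierCos_sub, H.cos_ψ k hk, sub_zero]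

theorem sin_x (H : GalerkinEq p n x ψ h) {k : ℕ} (hk : k ≤ n) :
    fourierSin k (x - ψ) = fourierSin k x := by
  rw [fourierSin_sub, H.sin_ψ k hk, sub_zero]

/-- Above frequency n the polynomial x is invisible, so x - ψ has the coefficients of -ψ there. -/
theorem sum_sq_tail_le (H : GalerkinEq p n x ψ h) (N : ℕ) :
    ∑ i ∈ Finset.range N, fourierCos (i + n + 1) (x - ψ) ^ 2 ≤ ‖ψ‖ ^ 2 ∧
      ∑ i ∈ Finset.range N, fourierSin (i + n + 1) (x - ψ) ^ 2 ≤ ‖ψ‖ ^ 2 := by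
  have h1 := sum_le_hasSum (Finset.range N) (fun i _ => by positivity)
    (hasSum_sq_tail H.cos_ψ H.sin_ψ)
  have hx : ∀ i, fourierCos (i + n + 1) (x - ψ) ^ 2 = fourierCos (i + n + 1) ψ ^ 2 ∧
      fourierSin (i + n + 1) (x - ψ) ^ 2 = fourierSin (i + n + 1) ψ ^ 2 := by
    intro i
    obtain ⟨h2, h3⟩ := fourier_eq_zero_of_mem_X (show n < i + n + 1 by omega) H.x_mem
    rw [fourierCos_sub, fourierSin_sub, h2, h3]
    simp
  rw [Finset.sum_add_distrib] at h1
  have h4 : 0 ≤ ∑ i ∈ Finset.range N, fourierCos (i + n + 1) ψ ^ 2 :=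
    Finset.sum_nonneg fun _ _ => sq_nonneg _
  have h5 : 0 ≤ ∑ i ∈ Finset.range N, fourierSin (i + n + 1) ψ ^ 2 :=
    Finset.sum_nonneg fun _ _ => sq_nonneg _
  simp_rw [fun i => (hx i).1, fun i => (hx i).2]
  constructor <;> linarith

end GalerkinEq

namespace GalerkinEq

variable {p n : ℕ} {x ψ h : L2}

theorem sq_norm_h (H : GalerkinEq p n x ψ h) :
    ‖h‖ ^ 2 = fourierCos 0 h ^ 2 / 2 + ∑ k ∈ Finset.range n, fourierCos (k + 1) h ^ 2
      + ∑ k ∈ Finset.range n, fourierSin (k + 1) h ^ 2 := sq_norm_of_mem_X H.h_mem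

theorem sum_sq_cos_le (H : GalerkinEq p n x ψ h) :
    ∑ k ∈ Finset.range n, fourierCos (k + 1) h ^ 2 ≤ ‖h‖ ^ 2 := by
  have h1 := H.sq_norm_h
  have h2 : 0 ≤ ∑ k ∈ Finset.range n, fourierSin (k + 1) h ^ 2 :=
    Finset.sum_nonneg fun _ _ => sq_nonneg _
  have h3 := sq_nonneg (fourierCos 0 h)
  linarith

theorem sum_sq_sin_le (H : GalerkinEq p n x ψ h) :
    ∑ k ∈ Finset.range n, fourierSin (k + 1) h ^ 2 ≤ ‖h‖ ^ 2 := by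
  have h1 := H.sq_norm_h
  have h2 : 0 ≤ ∑ k ∈ Finset.range n, fourierCos (k + 1) h ^ 2 :=
    Finset.sum_nonneg fun _ _ => sq_nonneg _
  have h3 := sq_nonneg (fourierCos 0 h)
  linarith

/-- The value at `0` of the trigonometric polynomial `h`, up to a factor, against the part of its
norm carried by the cosines. -/
theorem abs_value_le {n : ℕ} (hn : 1 ≤ n) {r : ℝ} (hr : 0 < r) (hrn : r ^ 2 = n) {c : ℕ → ℝ}
    {ζ N : ℝ} (hN : 0 ≤ N) (hc : ζ ^ 2 / 2 + ∑ k ∈ Finset.range n, c k ^ 2 ≤ N ^ 2) :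
    |ζ + 2 * ∑ k ∈ Finset.range n, c k| ≤ 2.45 * (r * N) := by
  have hn' : (1 : ℝ) ≤ n := by exact_mod_cast hn
  have h1 := sq_sum_weighted_le n 0 c
  simp only [pow_zero, one_mul, mul_zero, zero_add, pow_one] at h1
  set s := ∑ k ∈ Finset.range n, c k
  set q := ∑ k ∈ Finset.range n, c k ^ 2
  refine abs_le_of_sq_le_sq ?_ (by positivity)
  have hq : 0 ≤ q := Finset.sum_nonneg fun _ _ => sq_nonneg _
  -- Cauchy–Schwarz for the vectors (1, √2, …, √2) and (ζ, √2 c_1, …, √2 c_n). As 1 + 2n ≤ 3n, the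
  -- square is at most 6 n N², and 2.45² ≥ 6.
  have h2 : (ζ + 2 * s) ^ 2 ≤ (1 + 2 * n) * (ζ ^ 2 + 2 * q) := by
    have hpos : (0 : ℝ) < n := by linarith
    have h3 : n * (ζ + 2 * s) ^ 2 ≤ n * ((1 + 2 * n) * (ζ ^ 2 + 2 * q)) := by
      nlinarith [sq_nonneg (2 * n * ζ - 2 * s)]
    exact le_of_mul_le_mul_left h3 hpos
  have h4 : (1 + 2 * n) * (ζ ^ 2 + 2 * q) ≤ (3 * n) * (2 * N ^ 2) :=
    mul_le_mul (by linarith) (by linarith) (by positivity) (by positivity)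
  rw [mul_pow, mul_pow, hrn]
  nlinarith [sq_nonneg N, mul_nonneg (by linarith : (0 : ℝ) ≤ n) (sq_nonneg N)]

end GalerkinEq

theorem sq_pi_bounds : 9.86 < Real.pi ^ 2 ∧ Real.pi < 3.15 ∧ 3.14 < Real.pi := by
  have h1 := Real.pi_gt_d4
  have h2 := Real.pi_lt_d2
  refine ⟨by nlinarith, h2, by linarith⟩

theorem le_of_pi_mul_le {z B : ℝ} (hz : 0 ≤ z) (h : Real.pi * z ≤ 3.14 * B) : z ≤ B := by
  have h1 : 3.14 * z ≤ Real.pi * z := mul_le_mul_of_nonneg_right sq_pi_bounds.2.2.le hz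
  linarith

/-- Here z = √n |Z₀|, U and V are n times the cosine and sine parts of ‖h‖, and E = n‖h‖. Expanding,
with UV ≤ (U² + V²)/2, leaves at most 2.76 U² + 1.8 V², which is where the factor 3 is used. -/
theorem sq_bound_one {z U V M E : ℝ} (hz : 0 ≤ z) (hV : 0 ≤ V) (hM : 0 ≤ M) (hU : 0 ≤ U)
    (hE : E ^ 2 = U ^ 2 + V ^ 2) (hZ : z ≤ 0.8 * U + 0.65 * M) (hUE : U ≤ E) (hVE : V ≤ E) :
    1.5 * z ^ 2 + U ^ 2 + 2 * (z * V) + V ^ 2 ≤ 3 * (E + M) ^ 2 := by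
  have hz2 : z ^ 2 ≤ (0.8 * U + 0.65 * M) ^ 2 := pow_le_pow_left₀ hz hZ 2
  have hzV : z * V ≤ (0.8 * U + 0.65 * M) * V := mul_le_mul_of_nonneg_right hZ hV
  have h1 : U * M ≤ E * M := mul_le_mul_of_nonneg_right hUE hM
  have h2 : V * M ≤ E * M := mul_le_mul_of_nonneg_right hVE hM
  have h3 : 0 ≤ U * M := mul_nonneg hU hM
  have h4 := sq_nonneg (U - V)
  have h5 := sq_nonneg M
  have h6 := sq_nonneg U
  have h7 := sq_nonneg V
  ring_nf at *
  linarith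

/-- Cramer's rule. The determinant π² - qt is at least 9.86 - 4, and the constants come from (3·2.45
+ 3.15·2)/5.86 and (3.15·2.45 + 2·2)/5.86, rounded up. -/
theorem solve_two {z₀ z₁ ρ₁ ρ₂ q t G : ℝ} (hG : 0 ≤ G) (hq : 0 ≤ q) (hq3 : q ≤ 3) (ht : 0 ≤ t)
    (ht2 : t ≤ 2) (hqt : q * t ≤ 4) (h1 : q * z₁ = Real.pi * z₀ + ρ₁)
    (h2 : Real.pi * z₁ - t * z₀ = ρ₂) (hρ₁ : |ρ₁| ≤ 2 * G) (hρ₂ : |ρ₂| ≤ 2.45 * G) :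
    |z₀| ≤ 2.4 * G ∧ |z₁| ≤ 2.3 * G := by
  obtain ⟨p1, p2, p3⟩ := sq_pi_bounds
  have e0 : z₀ * (Real.pi ^ 2 - q * t) = q * ρ₂ - Real.pi * ρ₁ := by
    linear_combination (-Real.pi) * h1 + q * h2
  have e1 : z₁ * (Real.pi ^ 2 - q * t) = Real.pi * ρ₂ - t * ρ₁ := by
    linear_combination (-t) * h1 + Real.pi * h2
  have hd : 5.86 ≤ Real.pi ^ 2 - q * t := by linarith
  have habs : ∀ z R B : ℝ, z * (Real.pi ^ 2 - q * t) = R → |R| ≤ 5.86 * B → |z| ≤ B := by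
    intro z R B hz hR
    rw [← hz, abs_mul, abs_of_pos (by linarith : 0 < Real.pi ^ 2 - q * t)] at hR
    nlinarith [abs_nonneg z]
  have m1 : |q * ρ₂| ≤ 3 * (2.45 * G) := by
    rw [abs_mul, abs_of_nonneg hq]
    exact mul_le_mul hq3 hρ₂ (abs_nonneg _) (by norm_num)
  have m2 : |Real.pi * ρ₁| ≤ 3.15 * (2 * G) := by
    rw [abs_mul, abs_of_pos Real.pi_pos]
    exact mul_le_mul p2.le hρ₁ (abs_nonneg _) (by norm_num)
  have m3 : |Real.pi * ρ₂| ≤ 3.15 * (2.45 * G) := by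
    rw [abs_mul, abs_of_pos Real.pi_pos]
    exact mul_le_mul p2.le hρ₂ (abs_nonneg _) (by norm_num)
  have m4 : |t * ρ₁| ≤ 2 * (2 * G) := by
    rw [abs_mul, abs_of_nonneg ht]
    exact mul_le_mul ht2 hρ₁ (abs_nonneg _) (by norm_num)
  exact ⟨habs _ _ _ e0 ((abs_sub _ _).trans (by linarith)),
    habs _ _ _ e1 ((abs_sub _ _).trans (by linarith))⟩

/-- Eliminating z₀ and z₂ leaves the factor π² - 2qt ≥ 9.86 - 8 in front of z₁; then z₀ and z₂
follow from the first and third equations upon division by π. -/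
theorem solve_three {z₀ z₁ z₂ ρ₁ ρ₂ ρ₃ q t G : ℝ} (hG : 0 ≤ G) (hq : 0 ≤ q) (hq3 : q ≤ 3)
    (ht : 0 ≤ t) (ht2 : t ≤ 2) (hqt : q * t ≤ 4) (h1 : q * z₁ = Real.pi * z₀ + ρ₁)
    (h2 : q * z₂ = Real.pi * z₁ - t * z₀ + ρ₂) (h3 : Real.pi * z₂ - t * z₁ = ρ₃)
    (hρ₁ : |ρ₁| ≤ 2 * G) (hρ₂ : |ρ₂| ≤ 2 * G) (hρ₃ : |ρ₃| ≤ 2.45 * G) :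
    |z₀| ≤ 10.3 * G ∧ |z₁| ≤ 9.6 * G ∧ |z₂| ≤ 7.2 * G := by
  obtain ⟨p1, p2, p3⟩ := sq_pi_bounds
  have e1 : z₁ * (Real.pi ^ 2 - 2 * (q * t)) = q * ρ₃ - Real.pi * ρ₂ - t * ρ₁ := by
    linear_combination (-t) * h1 - Real.pi * h2 + q * h3
  have hd : 1.86 ≤ Real.pi ^ 2 - 2 * (q * t) := by linarith
  have m1 : |q * ρ₃| ≤ 3 * (2.45 * G) := by
    rw [abs_mul, abs_of_nonneg hq]
    exact mul_le_mul hq3 hρ₃ (abs_nonneg _) (by norm_num)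
  have m2 : |Real.pi * ρ₂| ≤ 3.15 * (2 * G) := by
    rw [abs_mul, abs_of_pos Real.pi_pos]
    exact mul_le_mul p2.le hρ₂ (abs_nonneg _) (by norm_num)
  have m3 : |t * ρ₁| ≤ 2 * (2 * G) := by
    rw [abs_mul, abs_of_nonneg ht]
    exact mul_le_mul ht2 hρ₁ (abs_nonneg _) (by norm_num)
  have hz1 : |z₁| ≤ 9.6 * G := by
    have hR : |q * ρ₃ - Real.pi * ρ₂ - t * ρ₁| ≤ 1.86 * (9.6 * G) :=
      (abs_sub _ _).trans (by linarith [abs_sub (q * ρ₃) (Real.pi * ρ₂)])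
    rw [← e1, abs_mul, abs_of_pos (by linarith : 0 < Real.pi ^ 2 - 2 * (q * t))] at hR
    nlinarith [abs_nonneg z₁]
  have habs : ∀ z R B : ℝ, Real.pi * z = R → |R| ≤ 3.14 * B → |z| ≤ B := by
    intro z R B hz hR
    rw [← hz, abs_mul, abs_of_pos Real.pi_pos] at hR
    exact le_of_pi_mul_le (abs_nonneg z) hR
  have m4 : |q * z₁| ≤ 3 * (9.6 * G) := by
    rw [abs_mul, abs_of_nonneg hq]
    exact mul_le_mul hq3 hz1 (abs_nonneg _) (by norm_num)
  have m5 : |t * z₁| ≤ 2 * (9.6 * G) := by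
    rw [abs_mul, abs_of_nonneg ht]
    exact mul_le_mul ht2 hz1 (abs_nonneg _) (by norm_num)
  exact ⟨habs z₀ (q * z₁ - ρ₁) _ (by linarith) ((abs_sub _ _).trans (by linarith)), hz1,
    habs z₂ (t * z₁ + ρ₃) _ (by linarith) ((abs_add_le _ _).trans (by linarith))⟩

namespace GalerkinEq

variable {n : ℕ} {x ψ h : L2}

theorem norm_le_one (H : GalerkinEq 1 n x ψ h) (hn : 1 ≤ n) :
    ‖x‖ ≤ √3 * ((n : ℝ) ^ 1 * ‖h‖ + ‖ψ‖) := by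
  have hn' : (1 : ℝ) ≤ n := by exact_mod_cast hn
  obtain ⟨r, hr, hrn⟩ : ∃ r : ℝ, 0 < r ∧ r ^ 2 = n :=
    ⟨√n, by positivity, Real.sq_sqrt (by positivity)⟩
  have hM := norm_nonneg ψ
  set M := ‖ψ‖
  set f := x - ψ with hf
  set Z₀ := fourierCos 0 f with hZ₀
  have hα : ∀ k ∈ Finset.range n, fourierSin (k + 1) f / ((k : ℝ) + 1) = -fourierCos (k + 1) h := by
    intro k hk
    have hk' := Finset.mem_range.mp hk
    rw [H.cos_h (k + 1) (by omega), fourierCos_A_one]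
    ring
  have hxs : ∀ k ∈ Finset.range n, fourierSin (k + 1) x ^ 2
      = (((k : ℝ) + 1) ^ 1 * fourierCos (k + 1) h) ^ 2 := by
    intro k hk
    have hk' := Finset.mem_range.mp hk
    have hpos : (k : ℝ) + 1 ≠ 0 := by positivity
    have h1 := hα k hk
    rw [div_eq_iff hpos] at h1
    rw [← H.sin_x (by omega), ← hf, h1]
    ring
  have hxc : ∀ k ∈ Finset.range n, fourierCos (k + 1) x
      = Z₀ + ((k : ℝ) + 1) ^ 1 * fourierSin (k + 1) h := by
    intro k hk
    have hk' := Finset.mem_range.mp hk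
    have hpos : (k : ℝ) + 1 ≠ 0 := by positivity
    rw [← H.cos_x (by omega), H.sin_h (k + 1) (by omega), fourierSin_A_one]
    field_simp
    ring
  have hsplit := fourierCos_zero_A_one_split n f
  rw [Finset.sum_congr rfl hα, Finset.sum_neg_distrib, ← H.cos_h 0 (by omega)] at hsplit
  obtain ⟨-, hτ⟩ := tail_weighted_le hn hr hrn hM (fun N => (H.sum_sq_tail_le N).2) 0
  simp only [zero_add, pow_one, mul_zero] at hτ
  set τ := ∑' i : ℕ, fourierSin (i + n + 1) f / (((i + n : ℕ) : ℝ) + 1)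
  have hxn := sq_norm_of_mem_X H.x_mem
  rw [Finset.sum_congr rfl hxs, ← H.cos_x (by omega), ← hZ₀,
    Finset.sum_congr rfl fun k hk => by rw [hxc k hk]] at hxn
  have hhn := H.sq_norm_h
  have hq1 : 0 ≤ ∑ k ∈ Finset.range n, fourierCos (k + 1) h ^ 2 :=
    Finset.sum_nonneg fun _ _ => sq_nonneg _
  have hq2 : 0 ≤ ∑ k ∈ Finset.range n, fourierSin (k + 1) h ^ 2 :=
    Finset.sum_nonneg fun _ _ => sq_nonneg _
  -- The norm of h is split into its cosine part u and its sine part v: Z₀ sees only u, while the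
  -- cross term below sees only v.
  obtain ⟨u, hu0, hu⟩ : ∃ u : ℝ, 0 ≤ u ∧ fourierCos 0 h ^ 2 / 2
      + ∑ k ∈ Finset.range n, fourierCos (k + 1) h ^ 2 = u ^ 2 :=
    ⟨_, Real.sqrt_nonneg _, (Real.sq_sqrt (by positivity)).symm⟩
  obtain ⟨v, hv0, hv⟩ : ∃ v : ℝ, 0 ≤ v ∧ ∑ k ∈ Finset.range n, fourierSin (k + 1) h ^ 2 = v ^ 2 :=
    ⟨_, Real.sqrt_nonneg _, (Real.sq_sqrt hq2).symm⟩
  have hval := abs_value_le hn hr hrn hu0 hu.le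
  have hβ1 := abs_sum_weighted_le hr hrn hv0 hv.le 1
  have hβ2 := sum_weighted_sq_le n 1 fun k => fourierSin (k + 1) h
  have hα2 := sum_weighted_sq_le n 1 fun k => fourierCos (k + 1) h
  rw [hv] at hβ2
  have hα3 : ∑ k ∈ Finset.range n, fourierCos (k + 1) h ^ 2 ≤ u ^ 2 := by
    have := sq_nonneg (fourierCos 0 h)
    linarith
  have hexp : ∑ k ∈ Finset.range n, (Z₀ + ((k : ℝ) + 1) ^ 1 * fourierSin (k + 1) h) ^ 2
      = n * Z₀ ^ 2 + 2 * Z₀ * ∑ k ∈ Finset.range n, ((k : ℝ) + 1) ^ 1 * fourierSin (k + 1) h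
        + ∑ k ∈ Finset.range n, (((k : ℝ) + 1) ^ 1 * fourierSin (k + 1) h) ^ 2 := by
    simp_rw [add_sq]
    rw [Finset.sum_add_distrib, Finset.sum_add_distrib, ← Finset.mul_sum]
    simp
  rw [hexp] at hxn
  rw [hu, hv] at hhn
  set S := ∑ k ∈ Finset.range n, ((k : ℝ) + 1) ^ 1 * fourierSin (k + 1) h
  set s := ∑ k ∈ Finset.range n, fourierCos (k + 1) h
  have hπ := sq_pi_bounds
  -- The single equation πZ₀ = (ζ + 2s) - 2τ, with ζ = `fourierCos 0 h`; the constants are 2.45/3.14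
  -- and 2/3.14, rounded up.
  have hZ : r * |Z₀| ≤ 0.8 * (n * u) + 0.65 * M := by
    have e : Real.pi * Z₀ = (fourierCos 0 h + 2 * s) - 2 * τ := by linarith
    have h1 : Real.pi * |Z₀| ≤ 2.45 * (r * u) + 2 * (M / r) := by
      rw [← abs_of_pos Real.pi_pos, ← abs_mul, e]
      refine (abs_sub _ _).trans ?_
      rw [abs_mul 2 τ, abs_two]
      linarith
    have h2 : Real.pi * (r * |Z₀|) ≤ 2.45 * (n * u) + 2 * M := by
      calc Real.pi * (r * |Z₀|) = r * (Real.pi * |Z₀|) := by ring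
        _ ≤ r * (2.45 * (r * u) + 2 * (M / r)) := mul_le_mul_of_nonneg_left h1 hr.le
        _ = 2.45 * (n * u) + 2 * M := by
          rw [← hrn]
          field_simp
    have h3 : 0 ≤ n * u := by positivity
    exact le_of_pi_mul_le (by positivity) (by linarith)
  set z := r * |Z₀| with hz
  have hz0 : 0 ≤ z := by positivity
  have hzsq : z ^ 2 = n * Z₀ ^ 2 := by rw [hz, mul_pow, hrn, sq_abs]
  have hcross : 2 * Z₀ * S ≤ 2 * (z * (n * v)) := by
    have h1 : Z₀ * S ≤ |Z₀| * (r ^ (2 * 1 + 1) * v) :=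
      (le_abs_self _).trans (by rw [abs_mul]; exact mul_le_mul_of_nonneg_left hβ1 (abs_nonneg _))
    have h2 : |Z₀| * (r ^ (2 * 1 + 1) * v) = z * (n * v) := by
      rw [hz, ← hrn]
      ring
    linarith
  have hU : 0 ≤ n * u := by positivity
  have hV : 0 ≤ n * v := by positivity
  -- The factor 1.5 collects Z₀²/2 from the constant mode and n Z₀² from the n cosine modes.
  have hmain : ‖x‖ ^ 2 ≤ 1.5 * z ^ 2 + (n * u) ^ 2 + 2 * (z * (n * v)) + (n * v) ^ 2 := by
    have h1 : Z₀ ^ 2 ≤ z ^ 2 := by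
      rw [hzsq]
      exact le_mul_of_one_le_left (sq_nonneg _) hn'
    have h2 : (n : ℝ) ^ (2 * 1) * ∑ k ∈ Finset.range n, fourierCos (k + 1) h ^ 2 ≤ n ^ 2 * u ^ 2 :=
      mul_le_mul_of_nonneg_left hα3 (by positivity)
    have h3 : (n : ℝ) ^ (2 * 1) * v ^ 2 = (n * v) ^ 2 := by ring
    rw [hxn, mul_pow]
    linarith
  have hE : (n * ‖h‖) ^ 2 = (n * u) ^ 2 + (n * v) ^ 2 := by
    rw [mul_pow, hhn]
    ring
  have hE0 : 0 ≤ n * ‖h‖ := by positivity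
  have hUE : n * u ≤ n * ‖h‖ := abs_le_of_sq_le_sq' (by rw [hE]; exact le_add_of_nonneg_right (sq_nonneg _)) hE0 |>.2
  have hVE : n * v ≤ n * ‖h‖ := abs_le_of_sq_le_sq' (by rw [hE]; exact le_add_of_nonneg_left (sq_nonneg _)) hE0 |>.2
  rw [pow_one]
  refine abs_le_of_sq_le_sq' ?_ (by positivity) |>.2
  rw [mul_pow, Real.sq_sqrt (by norm_num)]
  exact hmain.trans (sq_bound_one hz0 hV hM hU hE hZ hUE hVE)

end GalerkinEq

/-! ### Stability for p = 2 and p = 3. -/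

theorem add_sq_le_two (a b : ℝ) : (a + b) ^ 2 ≤ 2 * (a ^ 2 + b ^ 2) := by
  nlinarith [sq_nonneg (a - b)]

theorem add_sq_le_three (a b c : ℝ) : (a + b + c) ^ 2 ≤ 3 * (a ^ 2 + b ^ 2 + c ^ 2) := by
  nlinarith [sq_nonneg (a - b), sq_nonneg (a - c), sq_nonneg (b - c)]

theorem sum_const_mul_weight_sq_le (n j : ℕ) (c : ℝ) :
    ∑ k ∈ Finset.range n, (((k : ℝ) + 1) ^ j * c) ^ 2 ≤ (n : ℝ) ^ (2 * j + 1) * c ^ 2 := by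
  simp_rw [mul_pow _ c]
  rw [← Finset.sum_mul]
  exact mul_le_mul_of_nonneg_right (sum_weights_sq_le n j) (sq_nonneg c)

/-- The tail of the series of `hasSum_fourierSin_div` for a function in the range of `A^{(1)}`. -/
theorem tail_A_one {n : ℕ} (g : L2)
    (hs : Summable fun i : ℕ => fourierCos (i + n + 1) g / (((i + n : ℕ) : ℝ) + 1) ^ 2) :
    ∑' i : ℕ, fourierSin (i + n + 1) (A 1 g) / (((i + n : ℕ) : ℝ) + 1)
      = ∑' i : ℕ, fourierCos (i + n + 1) g / (((i + n : ℕ) : ℝ) + 1) ^ 2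
        - fourierCos 0 g * ∑' i : ℕ, 1 / (((i + n : ℕ) : ℝ) + 1) ^ 2 := by
  rw [← tsum_mul_left, ← hs.tsum_sub ((summable_inv_sq_tail n).mul_left _)]
  refine tsum_congr fun i => ?_
  rw [fourierSin_A_one]
  field_simp

theorem cos_A_one_tail {n : ℕ} (g : L2) (i : ℕ) :
    fourierCos (i + n + 1) (A 1 g) / (((i + n : ℕ) : ℝ) + 1) ^ 2
      = -(fourierSin (i + n + 1) g / (((i + n : ℕ) : ℝ) + 1) ^ 3) := by
  rw [fourierCos_A_one]
  field_simp

/-- The rescaled length `(2n+1)/n` and tail sum `2n ∑_{k>n} 1/k²`. -/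
theorem scaled_bounds {n : ℕ} (hn : 1 ≤ n) {q t : ℝ} (hq : q = (2 * n + 1) / n)
    (ht : t = n * (2 * ∑' i : ℕ, 1 / (((i + n : ℕ) : ℝ) + 1) ^ 2)) :
    0 ≤ q ∧ q ≤ 3 ∧ 0 ≤ t ∧ t ≤ 2 ∧ q * t ≤ 4 := by
  have hn' : (1 : ℝ) ≤ n := by exact_mod_cast hn
  have hT := tsum_inv_sq_tail_le n
  have hT0 : 0 ≤ ∑' i : ℕ, 1 / (((i + n : ℕ) : ℝ) + 1) ^ 2 := tsum_nonneg fun i => by positivity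
  set T := ∑' i : ℕ, 1 / (((i + n : ℕ) : ℝ) + 1) ^ 2
  rw [le_div_iff₀ (by positivity)] at hT
  subst hq ht
  refine ⟨by positivity, ?_, by positivity, ?_, ?_⟩
  · rw [div_le_iff₀ (by positivity)]
    linarith
  · linarith
  · have : (2 * (n : ℝ) + 1) / n * (n * (2 * T)) = 2 * (T * (2 * n + 1)) := by
      field_simp
    linarith

/-- Rescaling by r^i brings every right-hand side to the common size G = r^k N + M, where r^k = n^p.
The condition 2 ≤ B absorbs the factor 2 in front of the tail. -/
theorem abs_scaled_le {r R a b B N M : ℝ} {i j k : ℕ} (hr : 0 < r)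
    (hR : R = a + 2 * b) (ha : |a| ≤ B * (r ^ j * N)) (hb : |b| ≤ M / r ^ i) (hk : i + j = k)
    (hB : 2 ≤ B) (hM : 0 ≤ M) : |r ^ i * R| ≤ B * (r ^ k * N + M) := by
  have h1 : |R| ≤ B * (r ^ j * N) + 2 * (M / r ^ i) := by
    rw [hR]
    refine (abs_add_le _ _).trans ?_
    rw [abs_mul, abs_two]
    linarith
  rw [abs_mul, abs_of_pos (pow_pos hr i)]
  calc r ^ i * |R| ≤ r ^ i * (B * (r ^ j * N) + 2 * (M / r ^ i)) :=
        mul_le_mul_of_nonneg_left h1 (by positivity)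
    _ = B * (r ^ k * N) + 2 * M := by
        rw [← hk, pow_add]
        field_simp
    _ ≤ _ := by
        rw [mul_add]
        linarith [mul_le_mul_of_nonneg_right hB hM]

/-- The constant satisfies 2.5·2.4² + 2·2.3² + 2 ≤ 5.2². -/
theorem sq_bound_two {X2 Z₀ Z₁ z₀ z₁ n r N M G α2 β2 : ℝ} (hn : 1 ≤ n) (hrn : r ^ 2 = n)
    (hM : 0 ≤ M) (hN : 0 ≤ N)
    (hz₀ : z₀ = r * Z₀) (hz₁ : z₁ = r ^ 3 * Z₁) (hG : G = n ^ 2 * N + M)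
    (hb : α2 + β2 ≤ n ^ 4 * N ^ 2)
    (hX : X2 ≤ Z₀ ^ 2 / 2 + 2 * (n * Z₀ ^ 2 + α2) + 2 * (β2 + n ^ 3 * Z₁ ^ 2))
    (h0 : |z₀| ≤ 2.4 * G) (h1 : |z₁| ≤ 2.3 * G) : X2 ≤ (5.2 * G) ^ 2 := by
  have hG0 : 0 ≤ G := by rw [hG]; positivity
  have e0 : z₀ ^ 2 = n * Z₀ ^ 2 := by rw [hz₀, ← hrn]; ring
  have e1 : z₁ ^ 2 = n ^ 3 * Z₁ ^ 2 := by rw [hz₁, ← hrn]; ring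
  have f0 : z₀ ^ 2 ≤ (2.4 * G) ^ 2 := sq_le_sq' (abs_le.mp h0).1 (abs_le.mp h0).2
  have f1 : z₁ ^ 2 ≤ (2.3 * G) ^ 2 := sq_le_sq' (abs_le.mp h1).1 (abs_le.mp h1).2
  have g0 : Z₀ ^ 2 ≤ n * Z₀ ^ 2 := le_mul_of_one_le_left (sq_nonneg _) hn
  have g1 : (n ^ 2 * N) ^ 2 ≤ G ^ 2 :=
    pow_le_pow_left₀ (by positivity) (by rw [hG]; linarith) 2
  have g2 : (n ^ 2 * N) ^ 2 = n ^ 4 * N ^ 2 := by ring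
  have g3 := sq_nonneg G
  rw [mul_pow] at f0 f1 ⊢
  linarith

/-- The constant satisfies 3.5·10.3² + 2·9.6² + 3·7.2² + 3 ≤ 28². -/
theorem sq_bound_three {X2 Z₀ Z₁ Z₂ z₀ z₁ z₂ n r N M G α2 β2 : ℝ} (hn : 1 ≤ n) (hrn : r ^ 2 = n)
    (hM : 0 ≤ M) (hN : 0 ≤ N)
    (hz₀ : z₀ = r * Z₀) (hz₁ : z₁ = r ^ 3 * Z₁) (hz₂ : z₂ = r ^ 5 * Z₂)
    (hG : G = n ^ 3 * N + M) (hb : α2 + β2 ≤ n ^ 6 * N ^ 2) (hα : 0 ≤ α2)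
    (hX : X2 ≤ Z₀ ^ 2 / 2 + 3 * (n * Z₀ ^ 2 + n ^ 5 * Z₂ ^ 2 + β2)
      + 2 * (α2 + n ^ 3 * Z₁ ^ 2))
    (h0 : |z₀| ≤ 10.3 * G) (h1 : |z₁| ≤ 9.6 * G) (h2 : |z₂| ≤ 7.2 * G) :
    X2 ≤ (28 * G) ^ 2 := by
  have hG0 : 0 ≤ G := by rw [hG]; positivity
  have e0 : z₀ ^ 2 = n * Z₀ ^ 2 := by rw [hz₀, ← hrn]; ring
  have e1 : z₁ ^ 2 = n ^ 3 * Z₁ ^ 2 := by rw [hz₁, ← hrn]; ring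
  have e2 : z₂ ^ 2 = n ^ 5 * Z₂ ^ 2 := by rw [hz₂, ← hrn]; ring
  have f0 : z₀ ^ 2 ≤ (10.3 * G) ^ 2 := sq_le_sq' (abs_le.mp h0).1 (abs_le.mp h0).2
  have f1 : z₁ ^ 2 ≤ (9.6 * G) ^ 2 := sq_le_sq' (abs_le.mp h1).1 (abs_le.mp h1).2
  have f2 : z₂ ^ 2 ≤ (7.2 * G) ^ 2 := sq_le_sq' (abs_le.mp h2).1 (abs_le.mp h2).2
  have g0 : Z₀ ^ 2 ≤ n * Z₀ ^ 2 := le_mul_of_one_le_left (sq_nonneg _) hn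
  have g1 : (n ^ 3 * N) ^ 2 ≤ G ^ 2 :=
    pow_le_pow_left₀ (by positivity) (by rw [hG]; linarith) 2
  have g2 : (n ^ 3 * N) ^ 2 = n ^ 6 * N ^ 2 := by ring
  have g3 := sq_nonneg G
  rw [mul_pow] at f0 f1 f2 ⊢
  linarith

namespace GalerkinEq

variable {p n : ℕ} {x ψ h : L2}

theorem norm_le_two (H : GalerkinEq 2 n x ψ h) (hn : 1 ≤ n) :
    ‖x‖ ≤ 5.2 * ((n : ℝ) ^ 2 * ‖h‖ + ‖ψ‖) := by
  have hn' : (1 : ℝ) ≤ n := by exact_mod_cast hn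
  obtain ⟨r, hr, hrn⟩ : ∃ r : ℝ, 0 < r ∧ r ^ 2 = n :=
    ⟨√n, by positivity, Real.sq_sqrt (by positivity)⟩
  have hM := norm_nonneg ψ
  have hN := norm_nonneg h
  have hch := H.cos_h
  have hsh := H.sin_h
  rw [A_two] at hch hsh
  set f := x - ψ with hf
  set Z₀ := fourierCos 0 f with hZ₀
  set Z₁ := fourierCos 0 (A 1 f) with hZ₁
  have hα : ∀ k ∈ Finset.range n,
      fourierSin (k + 1) (A 1 f) / ((k : ℝ) + 1) = -fourierCos (k + 1) h := by
    intro k hk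
    have hk' := Finset.mem_range.mp hk
    rw [hch (k + 1) (by omega), fourierCos_A_one]
    ring
  -- Inverting two integrations at a sine mode leaves the unknown mean Z₁; summed over k ≤ n it
  -- contributes -nZ₁, whence the coefficient 2n + 1 = qn in the first equation.
  have hβ : ∀ k ∈ Finset.range n, fourierSin (k + 1) f / ((k : ℝ) + 1)
      = -(((k : ℝ) + 1) ^ 1 * fourierSin (k + 1) h) - Z₁ := by
    intro k hk
    have hk' := Finset.mem_range.mp hk
    have hpos : (k : ℝ) + 1 ≠ 0 := by positivity
    rw [hsh (k + 1) (by omega), fourierSin_A_one, fourierCos_A_one]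
    field_simp
    ring
  have hxc : ∀ k ∈ Finset.range n, fourierCos (k + 1) x ^ 2
      ≤ 2 * (Z₀ ^ 2 + (((k : ℝ) + 1) ^ 2 * fourierCos (k + 1) h) ^ 2) := by
    intro k hk
    have hk' := Finset.mem_range.mp hk
    have hpos : (k : ℝ) + 1 ≠ 0 := by positivity
    have h1 := hα k hk
    rw [fourierSin_A_one, div_div, div_eq_iff (by positivity)] at h1
    have e : fourierCos (k + 1) x = Z₀ + -(((k : ℝ) + 1) ^ 2 * fourierCos (k + 1) h) := by
      rw [← H.cos_x (by omega)]
      linear_combination h1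
    rw [e]
    refine (add_sq_le_two _ _).trans ?_
    rw [neg_sq]
  have hxs : ∀ k ∈ Finset.range n, fourierSin (k + 1) x ^ 2
      ≤ 2 * ((((k : ℝ) + 1) ^ 2 * fourierSin (k + 1) h) ^ 2 + (((k : ℝ) + 1) ^ 1 * Z₁) ^ 2) := by
    intro k hk
    have hk' := Finset.mem_range.mp hk
    have hpos : (k : ℝ) + 1 ≠ 0 := by positivity
    have h1 := hβ k hk
    rw [div_eq_iff hpos] at h1
    have e : fourierSin (k + 1) x = -(((k : ℝ) + 1) ^ 2 * fourierSin (k + 1) h)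
        + -(((k : ℝ) + 1) ^ 1 * Z₁) := by
      rw [← H.sin_x (by omega)]
      linear_combination h1
    rw [e]
    refine (add_sq_le_two _ _).trans ?_
    rw [neg_sq, neg_sq]
  have hs1 := fourierCos_zero_A_one_split n f
  rw [Finset.sum_congr rfl hβ, Finset.sum_sub_distrib, Finset.sum_neg_distrib, Finset.sum_const,
    Finset.card_range, nsmul_eq_mul] at hs1
  have hs2 := fourierCos_zero_A_one_split n (A 1 f)
  obtain ⟨-, hτ1⟩ := tail_weighted_le hn hr hrn hM (fun N => (H.sum_sq_tail_le N).2) 0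
  obtain ⟨hsum, hτ2⟩ := tail_weighted_le hn hr hrn hM (fun N => (H.sum_sq_tail_le N).1) 1
  rw [Finset.sum_congr rfl hα, Finset.sum_neg_distrib, tail_A_one f hsum,
    ← hch 0 (by omega)] at hs2
  simp only [zero_add, pow_one, mul_zero] at hτ1
  have hβ1 := abs_sum_weighted_le hr hrn hN H.sum_sq_sin_le 1
  have hval := abs_value_le hn hr hrn hN (ζ := fourierCos 0 h)
    (c := fun k => fourierCos (k + 1) h) (by
      have h1 := H.sq_norm_h
      have h2 : 0 ≤ ∑ k ∈ Finset.range n, fourierSin (k + 1) h ^ 2 :=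
        Finset.sum_nonneg fun _ _ => sq_nonneg _
      linarith)
  have hα2 := sum_weighted_sq_le n 2 fun k => fourierCos (k + 1) h
  have hβ2 := sum_weighted_sq_le n 2 fun k => fourierSin (k + 1) h
  have hX := sq_norm_of_mem_X H.x_mem
  rw [← H.cos_x (Nat.zero_le _), ← hf, ← hZ₀] at hX
  have hX1 := Finset.sum_le_sum hxc
  have hX2 := Finset.sum_le_sum hxs
  rw [← Finset.mul_sum, Finset.sum_add_distrib, Finset.sum_const, Finset.card_range,
    nsmul_eq_mul] at hX1
  rw [← Finset.mul_sum, Finset.sum_add_distrib] at hX2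
  have hX3 := sum_const_mul_weight_sq_le n 1 Z₁
  have hhn := H.sq_norm_h
  simp only [Nat.reduceMul, Nat.reduceAdd] at hβ1 hX3
  obtain ⟨hq, hq3, ht, ht2, hqt⟩ := scaled_bounds hn rfl rfl
  set τ1 := ∑' i : ℕ, fourierSin (i + n + 1) f / (((i + n : ℕ) : ℝ) + 1)
  set τ2 := ∑' i : ℕ, fourierCos (i + n + 1) f / (((i + n : ℕ) : ℝ) + 1) ^ (1 + 1)
  set T := ∑' i : ℕ, 1 / (((i + n : ℕ) : ℝ) + 1) ^ 2
  set S := ∑ k ∈ Finset.range n, ((k : ℝ) + 1) ^ 1 * fourierSin (k + 1) h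
  set s := ∑ k ∈ Finset.range n, fourierCos (k + 1) h
  set q : ℝ := (2 * n + 1) / n with hqdef
  set t : ℝ := n * (2 * T) with htdef
  have hqn : q * n = 2 * n + 1 := by
    rw [hqdef]
    field_simp
  -- The identity for f, multiplied by 2r, and the one for `A 1 f`, multiplied by -2r³, become a
  -- system in z₀ = rZ₀ and z₁ = r³Z₁. The coefficient t comes from the mean Z₀ present in every
  -- tail coefficient of `A 1 f`.
  have e1 : q * (r ^ 3 * Z₁) = Real.pi * (r * Z₀) + r ^ 1 * (-(2 * S) + 2 * τ1) := by
    linear_combination (2 * r) * hs1 + r * Z₁ * hqn + q * Z₁ * r * hrn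
  have e2 : Real.pi * (r ^ 3 * Z₁) - t * (r * Z₀)
      = r ^ 3 * ((fourierCos 0 h + 2 * s) + 2 * -τ2) := by
    rw [htdef]
    linear_combination (-2 * r ^ 3) * hs2 + 2 * T * r * Z₀ * hrn
  have hr4 : r ^ 4 = n ^ 2 := by rw [← hrn]; ring
  have hρ1 := abs_scaled_le (N := ‖h‖) (M := ‖ψ‖) (B := 2) (i := 1) (j := 3) (k := 4) hr rfl
    (a := -(2 * S)) (b := τ1)
    (by rw [abs_neg, abs_mul, abs_two]; linarith) (by simpa using hτ1) rfl le_rfl hM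
  have hρ2 := abs_scaled_le (N := ‖h‖) (M := ‖ψ‖) (B := 2.45) (i := 3) (j := 1) (k := 4) hr rfl
    (a := fourierCos 0 h + 2 * s) (b := -τ2)
    (by simpa using hval) (by rw [abs_neg]; exact hτ2) rfl (by norm_num) hM
  rw [hr4] at hρ1 hρ2
  have hG0 : 0 ≤ (n : ℝ) ^ 2 * ‖h‖ + ‖ψ‖ := by positivity
  obtain ⟨b0, b1⟩ := solve_two hG0 hq hq3 ht ht2 hqt e1 e2 hρ1 hρ2
  refine abs_le_of_sq_le_sq' ?_ (by positivity) |>.2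
  refine sq_bound_two hn' hrn hM hN rfl rfl rfl ?_ ?_ b0 b1
    (α2 := ∑ k ∈ Finset.range n, (((k : ℝ) + 1) ^ 2 * fourierCos (k + 1) h) ^ 2)
    (β2 := ∑ k ∈ Finset.range n, (((k : ℝ) + 1) ^ 2 * fourierSin (k + 1) h) ^ 2)
  · refine (add_le_add hα2 hβ2).trans ?_
    rw [← mul_add]
    refine mul_le_mul_of_nonneg_left ?_ (by positivity)
    have := sq_nonneg (fourierCos 0 h)
    linarith
  · linarith

theorem norm_le_three (H : GalerkinEq 3 n x ψ h) (hn : 1 ≤ n) :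
    ‖x‖ ≤ 28 * ((n : ℝ) ^ 3 * ‖h‖ + ‖ψ‖) := by
  have hn' : (1 : ℝ) ≤ n := by exact_mod_cast hn
  obtain ⟨r, hr, hrn⟩ : ∃ r : ℝ, 0 < r ∧ r ^ 2 = n :=
    ⟨√n, by positivity, Real.sq_sqrt (by positivity)⟩
  have hM := norm_nonneg ψ
  have hN := norm_nonneg h
  have hch := H.cos_h
  have hsh := H.sin_h
  rw [A_three] at hch hsh
  set f := x - ψ with hf
  set Z₀ := fourierCos 0 f with hZ₀
  set Z₁ := fourierCos 0 (A 1 f) with hZ₁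
  set Z₂ := fourierCos 0 (A 1 (A 1 f)) with hZ₂
  have hγ : ∀ k ∈ Finset.range n,
      fourierSin (k + 1) (A 1 (A 1 f)) / ((k : ℝ) + 1) = -fourierCos (k + 1) h := by
    intro k hk
    have hk' := Finset.mem_range.mp hk
    rw [hch (k + 1) (by omega), fourierCos_A_one]
    ring
  have hβ : ∀ k ∈ Finset.range n, fourierSin (k + 1) (A 1 f) / ((k : ℝ) + 1)
      = -(((k : ℝ) + 1) ^ 1 * fourierSin (k + 1) h) - Z₂ := by
    intro k hk
    have hk' := Finset.mem_range.mp hk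
    have hpos : (k : ℝ) + 1 ≠ 0 := by positivity
    rw [hsh (k + 1) (by omega), fourierSin_A_one k (A 1 (A 1 f)), fourierCos_A_one k (A 1 f)]
    field_simp
    ring
  have hα : ∀ k ∈ Finset.range n, fourierSin (k + 1) f / ((k : ℝ) + 1)
      = ((k : ℝ) + 1) ^ 2 * fourierCos (k + 1) h - Z₁ := by
    intro k hk
    have hk' := Finset.mem_range.mp hk
    have hpos : (k : ℝ) + 1 ≠ 0 := by positivity
    rw [hch (k + 1) (by omega), fourierCos_A_one, fourierSin_A_one, fourierCos_A_one]
    field_simp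
    ring
  have hxc : ∀ k ∈ Finset.range n, fourierCos (k + 1) x ^ 2
      ≤ 3 * (Z₀ ^ 2 + (((k : ℝ) + 1) ^ 2 * Z₂) ^ 2
        + (((k : ℝ) + 1) ^ 3 * fourierSin (k + 1) h) ^ 2) := by
    intro k hk
    have hk' := Finset.mem_range.mp hk
    have hpos : (k : ℝ) + 1 ≠ 0 := by positivity
    have h1 := hβ k hk
    rw [fourierSin_A_one, div_div, div_eq_iff (by positivity)] at h1
    have e : fourierCos (k + 1) x = Z₀ + -(((k : ℝ) + 1) ^ 2 * Z₂)
        + -(((k : ℝ) + 1) ^ 3 * fourierSin (k + 1) h) := by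
      rw [← H.cos_x (by omega)]
      linear_combination h1
    rw [e]
    refine (add_sq_le_three _ _ _).trans ?_
    rw [neg_sq, neg_sq]
  have hxs : ∀ k ∈ Finset.range n, fourierSin (k + 1) x ^ 2
      ≤ 2 * ((((k : ℝ) + 1) ^ 3 * fourierCos (k + 1) h) ^ 2 + (((k : ℝ) + 1) ^ 1 * Z₁) ^ 2) := by
    intro k hk
    have hk' := Finset.mem_range.mp hk
    have hpos : (k : ℝ) + 1 ≠ 0 := by positivity
    have h1 := hα k hk
    rw [div_eq_iff hpos] at h1
    have e : fourierSin (k + 1) x = ((k : ℝ) + 1) ^ 3 * fourierCos (k + 1) h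
        + -(((k : ℝ) + 1) ^ 1 * Z₁) := by
      rw [← H.sin_x (by omega)]
      linear_combination h1
    rw [e]
    refine (add_sq_le_two _ _).trans ?_
    rw [neg_sq]
  have hs1 := fourierCos_zero_A_one_split n f
  have hs2 := fourierCos_zero_A_one_split n (A 1 f)
  have hs3 := fourierCos_zero_A_one_split n (A 1 (A 1 f))
  obtain ⟨-, hτ1⟩ := tail_weighted_le hn hr hrn hM (fun N => (H.sum_sq_tail_le N).2) 0
  obtain ⟨hsum2, hτ2⟩ := tail_weighted_le hn hr hrn hM (fun N => (H.sum_sq_tail_le N).1) 1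
  obtain ⟨hsum3, hτ3⟩ := tail_weighted_le hn hr hrn hM (fun N => (H.sum_sq_tail_le N).2) 2
  rw [Finset.sum_congr rfl hα, Finset.sum_sub_distrib, Finset.sum_const,
    Finset.card_range, nsmul_eq_mul] at hs1
  rw [Finset.sum_congr rfl hβ, Finset.sum_sub_distrib, Finset.sum_neg_distrib, Finset.sum_const,
    Finset.card_range, nsmul_eq_mul, tail_A_one f hsum2] at hs2
  -- The third identity reaches the coefficients of f only after two further integrations, hence the
  -- tail with cubes.
  have hsum3' : Summable fun i : ℕ =>
      fourierCos (i + n + 1) (A 1 f) / (((i + n : ℕ) : ℝ) + 1) ^ 2 := by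
    simp_rw [cos_A_one_tail]
    exact hsum3.neg
  rw [Finset.sum_congr rfl hγ, Finset.sum_neg_distrib, tail_A_one (A 1 f) hsum3',
    tsum_congr (cos_A_one_tail f), tsum_neg, ← hch 0 (by omega)] at hs3
  simp only [zero_add, pow_one, mul_zero] at hτ1
  have hβ1 := abs_sum_weighted_le hr hrn hN H.sum_sq_sin_le 1
  have hα1 := abs_sum_weighted_le hr hrn hN H.sum_sq_cos_le 2
  have hval := abs_value_le hn hr hrn hN (ζ := fourierCos 0 h)
    (c := fun k => fourierCos (k + 1) h) (by
      have h1 := H.sq_norm_h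
      have h2 : 0 ≤ ∑ k ∈ Finset.range n, fourierSin (k + 1) h ^ 2 :=
        Finset.sum_nonneg fun _ _ => sq_nonneg _
      linarith)
  have hα2 := sum_weighted_sq_le n 3 fun k => fourierCos (k + 1) h
  have hβ2 := sum_weighted_sq_le n 3 fun k => fourierSin (k + 1) h
  have hX := sq_norm_of_mem_X H.x_mem
  rw [← H.cos_x (Nat.zero_le _), ← hf, ← hZ₀] at hX
  have hX1 := Finset.sum_le_sum hxc
  have hX2 := Finset.sum_le_sum hxs
  rw [← Finset.mul_sum, Finset.sum_add_distrib, Finset.sum_add_distrib, Finset.sum_const,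
    Finset.card_range, nsmul_eq_mul] at hX1
  rw [← Finset.mul_sum, Finset.sum_add_distrib] at hX2
  have hX3 := sum_const_mul_weight_sq_le n 1 Z₁
  have hX4 := sum_const_mul_weight_sq_le n 2 Z₂
  have hhn := H.sq_norm_h
  simp only [Nat.reduceMul, Nat.reduceAdd] at hα1 hβ1 hX3 hX4
  obtain ⟨hq, hq3, ht, ht2, hqt⟩ := scaled_bounds hn rfl rfl
  set τ1 := ∑' i : ℕ, fourierSin (i + n + 1) f / (((i + n : ℕ) : ℝ) + 1)
  set τ2 := ∑' i : ℕ, fourierCos (i + n + 1) f / (((i + n : ℕ) : ℝ) + 1) ^ (1 + 1)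
  set τ3 := ∑' i : ℕ, fourierSin (i + n + 1) f / (((i + n : ℕ) : ℝ) + 1) ^ (2 + 1)
  set T := ∑' i : ℕ, 1 / (((i + n : ℕ) : ℝ) + 1) ^ 2
  set S₁ := ∑ k ∈ Finset.range n, ((k : ℝ) + 1) ^ 1 * fourierSin (k + 1) h
  set S₂ := ∑ k ∈ Finset.range n, ((k : ℝ) + 1) ^ 2 * fourierCos (k + 1) h
  set s := ∑ k ∈ Finset.range n, fourierCos (k + 1) h
  set q : ℝ := (2 * n + 1) / n with hqdef
  set t : ℝ := n * (2 * T) with htdef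
  have hqn : q * n = 2 * n + 1 := by
    rw [hqdef]
    field_simp
  -- Three splittings, for f, `A 1 f` and `A 1 (A 1 f)`, in the unknowns rZ₀, r³Z₁, r⁵Z₂; only the
  -- last contains the known mean of h.
  have e1 : q * (r ^ 3 * Z₁) = Real.pi * (r * Z₀) + r ^ 1 * (2 * S₂ + 2 * τ1) := by
    linear_combination (2 * r) * hs1 + r * Z₁ * hqn + q * Z₁ * r * hrn
  have e2 : q * (r ^ 5 * Z₂) = Real.pi * (r ^ 3 * Z₁) - t * (r * Z₀)
      + r ^ 3 * (-(2 * S₁) + 2 * τ2) := by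
    rw [htdef]
    linear_combination (2 * r ^ 3) * hs2 + r ^ 3 * Z₂ * hqn + q * Z₂ * r ^ 3 * hrn
      - 2 * T * r * Z₀ * hrn
  have e3 : Real.pi * (r ^ 5 * Z₂) - t * (r ^ 3 * Z₁)
      = r ^ 5 * ((fourierCos 0 h + 2 * s) + 2 * τ3) := by
    rw [htdef]
    linear_combination (-2 * r ^ 5) * hs3 + 2 * T * r ^ 3 * Z₁ * hrn
  have hr6 : r ^ 6 = n ^ 3 := by rw [← hrn]; ring
  have hρ1 := abs_scaled_le (N := ‖h‖) (M := ‖ψ‖) (B := 2) (i := 1) (j := 5) (k := 6) hr rfl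
    (a := 2 * S₂) (b := τ1)
    (by rw [abs_mul, abs_two]; linarith) (by simpa using hτ1) rfl le_rfl hM
  have hρ2 := abs_scaled_le (N := ‖h‖) (M := ‖ψ‖) (B := 2) (i := 3) (j := 3) (k := 6) hr rfl
    (a := -(2 * S₁)) (b := τ2)
    (by rw [abs_neg, abs_mul, abs_two]; linarith) hτ2 rfl le_rfl hM
  have hρ3 := abs_scaled_le (N := ‖h‖) (M := ‖ψ‖) (B := 2.45) (i := 5) (j := 1) (k := 6) hr rfl
    (a := fourierCos 0 h + 2 * s) (b := τ3)
    (by simpa using hval) hτ3 rfl (by norm_num) hM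
  rw [hr6] at hρ1 hρ2 hρ3
  have hG0 : 0 ≤ (n : ℝ) ^ 3 * ‖h‖ + ‖ψ‖ := by positivity
  obtain ⟨b0, b1, b2⟩ := solve_three hG0 hq hq3 ht ht2 hqt e1 e2 e3 hρ1 hρ2 hρ3
  refine abs_le_of_sq_le_sq' ?_ (by positivity) |>.2
  refine sq_bound_three hn' hrn hM hN rfl rfl rfl rfl ?_ ?_ ?_ b0 b1 b2
    (α2 := ∑ k ∈ Finset.range n, (((k : ℝ) + 1) ^ 3 * fourierCos (k + 1) h) ^ 2)
    (β2 := ∑ k ∈ Finset.range n, (((k : ℝ) + 1) ^ 3 * fourierSin (k + 1) h) ^ 2)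
  · refine (add_le_add hα2 hβ2).trans ?_
    rw [← mul_add]
    refine mul_le_mul_of_nonneg_left ?_ (by positivity)
    have := sq_nonneg (fourierCos 0 h)
    linarith
  · positivity
  · linarith

end GalerkinEq

/-! ### Test functions -/

/-- `φ ∈ C_0^∞(0, 2π)`. -/
structure IsTest (φ : ℝ → ℝ) : Prop where
  contDiff : ContDiff ℝ (⊤ : ℕ∞) φ
  compact : HasCompactSupport φ
  support : tsupport φ ⊆ Ioo 0 (2 * Real.pi)

namespace IsTest

variable {φ θ : ℝ → ℝ}

theorem deriv (h : IsTest φ) : IsTest (deriv φ) :=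
  ⟨(contDiff_infty_iff_deriv.mp h.contDiff).2, h.compact.deriv,
    (tsupport_deriv_subset (𝕜 := ℝ)).trans h.support⟩

theorem iteratedDeriv (h : IsTest φ) (k : ℕ) : IsTest (iteratedDeriv k φ) := by
  induction k with
  | zero => rwa [iteratedDeriv_zero]
  | succ k ih =>
    rw [iteratedDeriv_succ]
    exact ih.deriv

theorem continuous (h : IsTest φ) : Continuous φ := h.contDiff.continuous

theorem eq_zero (h : IsTest φ) {x : ℝ} (hx : x ∉ Ioo 0 (2 * Real.pi)) : φ x = 0 :=
  image_eq_zero_of_notMem_tsupport fun hx' => hx (h.support hx')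

theorem exists_bounds (h : IsTest φ) :
    ∃ a b : ℝ, 0 < a ∧ b < 2 * Real.pi ∧ ∀ x, x ∉ Icc a b → φ x = 0 := by
  -- Inserting π keeps the set nonempty when φ = 0.
  have hK : IsCompact (insert Real.pi (tsupport φ)) := h.compact.isCompact.insert _
  have hsub : insert Real.pi (tsupport φ) ⊆ Ioo 0 (2 * Real.pi) :=
    insert_subset ⟨Real.pi_pos, by linarith [Real.pi_pos]⟩ h.support
  obtain ⟨a, ha⟩ := hK.exists_isLeast (insert_nonempty _ _)
  obtain ⟨b, hb⟩ := hK.exists_isGreatest (insert_nonempty _ _)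
  refine ⟨a, b, (hsub ha.1).1, (hsub hb.1).2, fun x hx => ?_⟩
  refine image_eq_zero_of_notMem_tsupport fun hx' => hx ⟨ha.2 ?_, hb.2 ?_⟩ <;>
    exact mem_insert_of_mem _ hx'

theorem sub_const_mul (h : IsTest φ) (hθ : IsTest θ) (c : ℝ) :
    IsTest fun x => φ x - c * θ x := by
  have hs : tsupport (fun x => φ x - c * θ x) ⊆ tsupport φ ∪ tsupport θ := by
    refine closure_minimal (fun x hx => ?_) ((isClosed_tsupport _).union (isClosed_tsupport _))
    by_contra hx'
    rw [mem_union, not_or] at hx'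
    have h0 : φ x - c * θ x = 0 := by
      rw [image_eq_zero_of_notMem_tsupport hx'.1, image_eq_zero_of_notMem_tsupport hx'.2]
      ring
    exact hx h0
  refine ⟨h.contDiff.sub (contDiff_const.mul hθ.contDiff), ?_,
    hs.trans (union_subset h.support hθ.support)⟩
  exact (h.compact.isCompact.union hθ.compact.isCompact).of_isClosed_subset
    (isClosed_tsupport _) hs

/-- A test function of mean zero is the derivative of a test function. -/
theorem exists_primitive (h : IsTest φ) (h0 : ∫ t in (0 : ℝ)..(2 * Real.pi), φ t = 0) :
    ∃ χ, IsTest χ ∧ _root_.deriv χ = φ := by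
  obtain ⟨a, b, ha, hb, hab⟩ := h.exists_bounds
  have hc := h.continuous
  have hd : ∀ x, HasDerivAt (fun x => ∫ t in (0 : ℝ)..x, φ t) (φ x) x := fun x =>
    (hc.integral_hasStrictDerivAt 0 x).hasDerivAt
  have hd' : _root_.deriv (fun x => ∫ t in (0 : ℝ)..x, φ t) = φ := funext fun x => (hd x).deriv
  have hz : ∀ u v, (∀ x ∈ uIoc u v, φ x = 0) → ∫ t in u..v, φ t = 0 := by
    intro u v huv
    rw [intervalIntegral.integral_congr_ae (g := fun _ => (0 : ℝ))
      (Filter.Eventually.of_forall huv)]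
    simp
  -- Left of a nothing has been integrated yet; right of b the integral is already the total one,
  -- which is zero.
  have hs : tsupport (fun x => ∫ t in (0 : ℝ)..x, φ t) ⊆ Icc a b := by
    refine closure_minimal (fun x hx => ?_) isClosed_Icc
    by_contra hx'
    refine hx ?_
    rw [mem_Icc, not_and_or, not_le, not_le] at hx'
    rcases hx' with hx' | hx'
    · refine hz _ _ fun t ht => hab t fun ht' => ?_
      have h1 : t ≤ max 0 x := (mem_uIoc.mp ht).elim (fun h => h.2.trans (le_max_right _ _))
        (fun h => h.2.trans (le_max_left _ _))
      exact absurd (ht'.1.trans h1) (not_le.mpr (max_lt ha hx'))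
    · have h2 := intervalIntegral.integral_add_adjacent_intervals
        (hc.intervalIntegrable (μ := volume) 0 x) (hc.intervalIntegrable x (2 * Real.pi))
      rw [h0, hz x (2 * Real.pi)] at h2
      · linarith
      · intro t ht
        refine hab t fun ht' => ?_
        have h1 : min x (2 * Real.pi) < t := (mem_uIoc.mp ht).elim
          (fun h => (min_le_left _ _).trans_lt h.1) (fun h => (min_le_right _ _).trans_lt h.1)
        exact absurd (h1.trans_le ht'.2) (not_lt.mpr (lt_min hx' hb).le)
  refine ⟨_, ⟨contDiff_infty_iff_deriv.mpr ⟨fun x => (hd x).differentiableAt, ?_⟩, ?_, ?_⟩, hd'⟩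
  · rw [hd']
    exact h.contDiff
  · exact isCompact_Icc.of_isClosed_subset (isClosed_tsupport _) hs
  · exact hs.trans fun x hx => ⟨ha.trans_le hx.1, hx.2.trans_lt hb⟩

theorem exists_integral_eq_one : ∃ θ, IsTest θ ∧ ∫ t in (0 : ℝ)..(2 * Real.pi), θ t = 1 := by
  have hπ := Real.pi_gt_three
  let f : ContDiffBump Real.pi := ⟨1, 2, one_pos, one_lt_two⟩
  have hs : tsupport (f.normed volume) ⊆ Ioo 0 (2 * Real.pi) := by
    rw [f.tsupport_normed_eq, Real.closedBall_eq_Icc]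
    change Icc (Real.pi - 2) (Real.pi + 2) ⊆ _
    exact fun x hx => ⟨by linarith [hx.1], by linarith [hx.2]⟩
  have ht : IsTest (f.normed volume) := ⟨f.contDiff_normed, f.hasCompactSupport_normed, hs⟩
  refine ⟨_, ht, ?_⟩
  rw [← integral_eq_interval, ← f.integral_normed (μ := volume)]
  exact setIntegral_eq_integral_of_forall_compl_eq_zero fun x hx => ht.eq_zero hx

end IsTest

/-! ### Weak derivatives of Volterra integrals -/

theorem hasWeakDeriv_iff {k : ℕ} {y ζ : L2} : HasWeakDeriv k y ζ ↔ ∀ φ, IsTest φ →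
    ∫ x, ζ x * φ x ∂μ = (-1) ^ k * ∫ x, y x * iteratedDeriv k φ x ∂μ :=
  ⟨fun h φ hφ => h φ hφ.contDiff hφ.compact hφ.support, fun h φ h1 h2 h3 => h φ ⟨h1, h2, h3⟩⟩

/-- Integration by parts, read off from Fubini: the integral of χ' from s to 2π is -χ(s). -/
theorem integral_mul_test (f : L2) {χ : ℝ → ℝ} (hχ : IsTest χ) :
    ∫ x, f x * χ x ∂μ = -∫ x, A 1 f x * deriv χ x ∂μ := by
  rw [integral_A_one_mul f hχ.deriv.continuous, ← integral_neg]
  refine integral_congr_ae (Filter.Eventually.of_forall fun s => ?_)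
  beta_reduce
  rw [intervalIntegral.integral_deriv_eq_sub
    (fun x _ => (hχ.contDiff.differentiable (by simp)).differentiableAt)
    (hχ.deriv.continuous.intervalIntegrable _ _), hχ.eq_zero (x := 2 * Real.pi) (by simp)]
  ring

theorem hasWeakDeriv_A (p : ℕ) (f : L2) : HasWeakDeriv (p + 1) (A (p + 1) f) f := by
  induction p generalizing f with
  | zero =>
    refine hasWeakDeriv_iff.mpr fun χ hχ => ?_
    rw [integral_mul_test f hχ, zero_add, iteratedDeriv_one]
    ring
  | succ p ih =>
    refine hasWeakDeriv_iff.mpr fun χ hχ => ?_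
    rw [integral_mul_test f hχ, hasWeakDeriv_iff.mp (ih (A 1 f)) _ hχ.deriv, A_succ_succ,
      iteratedDeriv_succ' (n := p + 1)]
    ring

/-- Exhibits x^p/p! as an iterated primitive of 1, which gives its weak derivative of order p. -/
theorem A_monomial_zero (p : ℕ) :
    A (p + 1) (monomial 0) = (1 / ((p + 1).factorial : ℝ)) • monomial (p + 1) := by
  unfold monomial ofContinuous
  rw [← MemLp.toLp_const_smul]
  refine MemLp.toLp_congr (memLp_integralFun _ _)
    ((memLp_of_continuous (continuous_pow (p + 1))).const_smul _) ?_
  filter_upwards [ae_mem] with x hx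
  have h : (fun t => (x - t) ^ p * monomial 0 t) =ᵐ[μ] fun t => (x - t) ^ p := by
    filter_upwards [coeFn_monomial 0] with t ht
    rw [ht, pow_zero, mul_one]
  change integralFun (p + 1) (monomial 0) x = _
  unfold integralFun
  simp only [Nat.add_sub_cancel]
  rw [interval_integral_congr_ae h (Ioo_subset_Icc_self hx),
    intervalIntegral.integral_comp_sub_left (fun t => t ^ p) x, integral_pow]
  simp only [sub_self, sub_zero, Pi.smul_apply, smul_eq_mul]
  rw [Nat.factorial_succ]
  have : (p : ℝ) + 1 ≠ 0 := by positivity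
  push_cast
  field_simp
  simp

theorem hasWeakDeriv_monomial (p : ℕ) :
    HasWeakDeriv p ((1 / (p.factorial : ℝ)) • monomial p) (monomial 0) := by
  cases p with
  | zero => exact hasWeakDeriv_iff.mpr fun φ _ => by simp
  | succ p =>
    rw [← A_monomial_zero]
    exact hasWeakDeriv_A p _

theorem integral_sub_smul_mul (v m : L2) (c : ℝ) {g : ℝ → ℝ} (hg : Continuous g) :
    ∫ x, (v - c • m : L2) x * g x ∂μ = ∫ x, v x * g x ∂μ - c * ∫ x, m x * g x ∂μ := by
  rw [← integral_const_mul, ← integral_sub (integrable_mul_continuous v hg)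
    ((integrable_mul_continuous m hg).const_mul c)]
  refine integral_congr_ae ?_
  filter_upwards [Lp.coeFn_sub v (c • m), Lp.coeFn_smul c m] with x h1 h2
  rw [h1, Pi.sub_apply, h2, Pi.smul_apply, smul_eq_mul]
  ring

/-- The lemma of du Bois-Reymond for derivatives of order `p`. -/
theorem eq_polynomial_of_integral_eq_zero (p : ℕ) (v : L2)
    (hv : ∀ φ, IsTest φ → ∫ x, v x * iteratedDeriv p φ x ∂μ = 0) :
    ∃ c : ℕ → ℝ, v = ∑ k ∈ Finset.range p, c k • monomial k := by
  induction p generalizing v with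
  | zero =>
    refine ⟨0, ?_⟩
    rw [Finset.range_zero, Finset.sum_empty]
    have h := isOpen_Ioo.ae_eq_zero_of_integral_contDiff_smul_eq_zero (U := Ioo 0 (2 * Real.pi))
      (f := v) (μ := μ) ((integrable_coe v).locallyIntegrable.locallyIntegrableOn _)
      (fun g h1 h2 h3 => by
        have := hv g ⟨h1, h2, h3⟩
        simp only [iteratedDeriv_zero] at this
        simpa [mul_comm] using this)
    refine Lp.ext ?_
    filter_upwards [h, ae_mem, Lp.coeFn_zero ℝ 2 μ] with x h1 h2 h3
    rw [h1 h2, h3, Pi.zero_apply]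
  | succ p ih =>
    obtain ⟨θ, hθ, hθ1⟩ := IsTest.exists_integral_eq_one
    set m : L2 := (1 / (p.factorial : ℝ)) • monomial p with hm
    -- Up to the multiple I θ with I = ∫φ, φ is the derivative of a test function χ. Testing v with
    -- χ gives ∫ v φ^{(p)} = I ∫ v θ^{(p)}, while I = (-1)^p ∫ m φ^{(p)}. So v - c m annihilates all
    -- φ^{(p)}, and the induction hypothesis applies.
    set c := (-1) ^ p * ∫ x, v x * iteratedDeriv p θ x ∂μ with hc
    obtain ⟨d, hd⟩ := ih (v - c • m) fun φ hφ => by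
      have h1 := hasWeakDeriv_iff.mp (hasWeakDeriv_monomial p) φ hφ
      rw [← hm] at h1
      have h2 : ∫ x, (monomial 0 : L2) x * φ x ∂μ = ∫ t in (0 : ℝ)..(2 * Real.pi), φ t := by
        rw [← integral_eq_interval]
        refine integral_congr_ae ?_
        filter_upwards [coeFn_monomial 0] with x hx
        rw [hx, pow_zero, one_mul]
      rw [h2] at h1
      set I := ∫ t in (0 : ℝ)..(2 * Real.pi), φ t
      obtain ⟨χ, hχ, hχ'⟩ := (hφ.sub_const_mul hθ I).exists_primitive (by
        rw [intervalIntegral.integral_sub (hφ.continuous.intervalIntegrable _ _)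
          ((hθ.continuous.intervalIntegrable _ _).const_mul _),
          intervalIntegral.integral_const_mul, hθ1]
        ring)
      have h3 := hv χ hχ
      rw [iteratedDeriv_succ', hχ'] at h3
      have h4 : ∀ x, iteratedDeriv p (fun x => φ x - I * θ x) x
          = iteratedDeriv p φ x - I * iteratedDeriv p θ x := by
        intro x
        have hcθ : ContDiff ℝ (p : ℕ∞) θ := hθ.contDiff.of_le (by exact_mod_cast le_top)
        rw [iteratedDeriv_fun_sub (hφ.contDiff.of_le (by exact_mod_cast le_top)).contDiffAt
          (contDiff_const.mul hcθ).contDiffAt, iteratedDeriv_const_mul_field]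
      simp_rw [h4, mul_sub] at h3
      rw [integral_sub (integrable_mul_continuous v (hφ.iteratedDeriv p).continuous)
        (integrable_mul_continuous v ((hθ.iteratedDeriv p).continuous.const_mul I))] at h3
      have h5 : ∫ x, v x * (I * iteratedDeriv p θ x) ∂μ
          = I * ∫ x, v x * iteratedDeriv p θ x ∂μ := by
        rw [← integral_const_mul]
        refine integral_congr_ae (Filter.Eventually.of_forall fun x => ?_)
        ring
      rw [h5] at h3
      rw [integral_sub_smul_mul v m c (hφ.iteratedDeriv p).continuous, hc]
      linear_combination h3 + (∫ x, v x * iteratedDeriv p θ x ∂μ) * h1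
    refine ⟨fun k => if k = p then c * (1 / (p.factorial : ℝ)) else d k, ?_⟩
    beta_reduce
    rw [Finset.sum_range_succ, if_pos rfl, Finset.sum_congr rfl (g := fun k => d k • monomial k)
      (fun k hk => by rw [if_neg (Finset.mem_range.mp hk).ne]), ← hd, hm, smul_smul]
    abel

theorem exists_eq_A_add_polynomial {p : ℕ} {y : L2} (hy : MemH (p + 1) y) :
    ∃ c : ℕ → ℝ, y = A (p + 1) (weakDeriv (p + 1) y)
      + ∑ k ∈ Finset.range (p + 1), c k • monomial k := by
  have hw : HasWeakDeriv (p + 1) y (weakDeriv (p + 1) y) :=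
    Classical.epsilon_spec (hy (p + 1) (by simp))
  have hA := hasWeakDeriv_A p (weakDeriv (p + 1) y)
  obtain ⟨c, hc⟩ := eq_polynomial_of_integral_eq_zero (p + 1)
    (y - A (p + 1) (weakDeriv (p + 1) y)) fun φ hφ => by
      have h1 := hasWeakDeriv_iff.mp hw φ hφ
      have h2 := hasWeakDeriv_iff.mp hA φ hφ
      rw [h1] at h2
      have h3 := mul_left_cancel₀ (pow_ne_zero _ (by norm_num : (-1 : ℝ) ≠ 0)) h2
      have h4 := integral_sub_smul_mul y (A (p + 1) (weakDeriv (p + 1) y)) 1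
        (hφ.iteratedDeriv (p + 1)).continuous
      rw [one_smul] at h4
      rw [h4, h3]
      ring
  exact ⟨c, by rw [← hc]; abel⟩

/-! ### The fine representative -/

/-- Peels off the outermost integration, as the recursion for `primitive` requires; `A_succ_succ`
peels off the innermost. -/
theorem A_succ_eq_A_one (p : ℕ) (f : L2) : A (p + 2) f = A 1 (A (p + 1) f) := by
  induction p generalizing f with
  | zero => exact A_succ_succ 0 f
  | succ p ih => rw [A_succ_succ (p + 1), ih, ← A_succ_succ]

/-- The iterated primitives of `φ`, extended by zero outside of `(0, 2π)`. -/
noncomputable def primitive (φ : L2) : ℕ → ℝ → ℝ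
  | 0 => fun x => ∫ t in (0 : ℝ)..x, (Ioo 0 (2 * Real.pi)).indicator φ t
  | j + 1 => fun x => ∫ t in (0 : ℝ)..x, primitive φ j t

theorem primitive_zero_right (φ : L2) (j : ℕ) : primitive φ j 0 = 0 := by
  cases j <;> simp [primitive]

theorem primitive_zero_eq (φ : L2) {x : ℝ} (hx : x ∈ Icc 0 (2 * Real.pi)) :
    primitive φ 0 x = ∫ t in (0 : ℝ)..x, φ t := by
  refine interval_integral_congr_ae ?_ hx
  filter_upwards [ae_mem] with t ht
  exact indicator_of_mem ht _

theorem continuous_primitive_zero (φ : L2) : Continuous (primitive φ 0) := by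
  have h : Integrable ((Ioo 0 (2 * Real.pi)).indicator φ) volume :=
    (integrable_indicator_iff measurableSet_Ioo).mpr (integrable_coe φ)
  exact intervalIntegral.continuous_primitive (fun a b => h.intervalIntegrable) 0

theorem continuous_primitive (φ : L2) (j : ℕ) : Continuous (primitive φ j) := by
  induction j with
  | zero => exact continuous_primitive_zero φ
  | succ j ih => exact intervalIntegral.continuous_primitive (fun a b => ih.intervalIntegrable a b) 0

theorem deriv_primitive (φ : L2) (j : ℕ) : deriv (primitive φ (j + 1)) = primitive φ j :=
  funext fun x => (continuous_primitive φ j).deriv_integral _ 0 x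

theorem contDiff_primitive (φ : L2) (j : ℕ) : ContDiff ℝ j (primitive φ j) := by
  induction j with
  | zero => exact contDiff_zero.mpr (continuous_primitive φ 0)
  | succ j ih =>
    rw [Nat.cast_succ, contDiff_succ_iff_deriv, deriv_primitive]
    refine ⟨fun x => ?_, by simp, ih⟩
    exact ((continuous_primitive φ j).integral_hasStrictDerivAt 0 x).hasDerivAt.differentiableAt

theorem iteratedDeriv_primitive (φ : L2) (i j : ℕ) :
    iteratedDeriv i (primitive φ (i + j)) = primitive φ j := by
  induction i generalizing j with
  | zero => rw [iteratedDeriv_zero, zero_add]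
  | succ i ih => rw [iteratedDeriv_succ', add_right_comm, deriv_primitive, ih]

theorem coeFn_A_eq_primitive (φ : L2) (j : ℕ) : A (j + 1) φ =ᵐ[μ] primitive φ j := by
  induction j with
  | zero =>
    filter_upwards [coeFn_A 1 φ, ae_mem] with x hx hx'
    rw [hx, integralFun_one, primitive_zero_eq φ (Ioo_subset_Icc_self hx')]
  | succ j ih =>
    rw [A_succ_eq_A_one]
    filter_upwards [coeFn_A 1 (A (j + 1) φ), ae_mem] with x hx hx'
    rw [hx, integralFun_one, interval_integral_congr_ae ih (Ioo_subset_Icc_self hx')]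
    rfl

theorem coeFn_sum_smul_monomial (s : Finset ℕ) (c : ℕ → ℝ) :
    (∑ k ∈ s, c k • monomial k : L2) =ᵐ[μ] fun x => ∑ k ∈ s, c k * x ^ k := by
  induction s using Finset.induction_on with
  | empty =>
    filter_upwards [Lp.coeFn_zero ℝ 2 μ] with x hx
    rw [Finset.sum_empty, hx, Finset.sum_empty, Pi.zero_apply]
  | insert a s ha ih =>
    rw [Finset.sum_insert ha]
    filter_upwards [Lp.coeFn_add (c a • monomial a) (∑ k ∈ s, c k • monomial k), ih,
      Lp.coeFn_smul (c a) (monomial a), coeFn_monomial a] with x h1 h2 h3 h4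
    rw [h1, Pi.add_apply, h2, h3, Pi.smul_apply, h4, Finset.sum_insert ha, smul_eq_mul]

theorem uniqueDiffOn_interval : UniqueDiffOn ℝ (Icc 0 (2 * Real.pi)) :=
  uniqueDiffOn_Icc Real.two_pi_pos

/-- Continuous functions that agree almost everywhere on (0, 2π) agree on the closed interval, so
the arbitrary choice does not affect the one-sided derivatives at 0. -/
theorem fineRep_eqOn {p : ℕ} {y : L2} {u : ℝ → ℝ} (hu : MemU p u) (hyu : y =ᵐ[μ] u) :
    EqOn (fineRep p y) u (Icc 0 (2 * Real.pi)) := by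
  have h : MemU p (fineRep p y) ∧ y =ᵐ[μ] fineRep p y :=
    Classical.epsilon_spec (p := fun u : ℝ → ℝ => MemU p u ∧ y =ᵐ[μ] u) ⟨u, hu, hyu⟩
  refine Measure.eqOn_Icc_of_ae_eq volume Real.two_pi_pos.ne ?_ h.1.1.continuousOn
    hu.1.continuousOn
  rw [← Measure.restrict_congr_set Ioo_ae_eq_Icc]
  exact h.2.symm.trans hyu

theorem contDiff_sum_mul_pow (p j : ℕ) (c : ℕ → ℝ) :
    ContDiff ℝ j fun x : ℝ => ∑ k ∈ Finset.range p, c k * x ^ k := by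
  fun_prop

theorem iteratedDeriv_primitive_add_polynomial (φ : L2) {i j : ℕ} (hij : i ≤ j) (c : ℕ → ℝ)
    (x : ℝ) : iteratedDeriv i
      (fun x => primitive φ j x + ∑ k ∈ Finset.range (j + 1), c k * x ^ k) x
      = primitive φ (j - i) x
        + ∑ k ∈ Finset.range (j + 1), c k * (k.descFactorial i * x ^ (k - i)) := by
  obtain ⟨d, rfl⟩ := Nat.exists_eq_add_of_le hij
  rw [iteratedDeriv_fun_add
    ((contDiff_primitive φ (i + d)).of_le (by exact_mod_cast hij)).contDiffAt
    (contDiff_sum_mul_pow _ _ _).contDiffAt,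
    iteratedDeriv_primitive, Nat.add_sub_cancel_left,
    iteratedDeriv_fun_sum fun k _ => by fun_prop]
  simp_rw [iteratedDeriv_const_mul_field]
  congr 1
  refine Finset.sum_congr rfl fun k _ => ?_
  rw [iteratedDeriv_pow]

theorem memU_primitive_add_polynomial (φ : L2) (j : ℕ) (c : ℕ → ℝ) :
    MemU (j + 1) fun x => primitive φ j x + ∑ k ∈ Finset.range (j + 1), c k * x ^ k := by
  have hc : ContDiff ℝ j fun x => primitive φ j x + ∑ k ∈ Finset.range (j + 1), c k * x ^ k :=
    (contDiff_primitive φ j).add (contDiff_sum_mul_pow _ _ _)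
  refine ⟨hc.contDiffOn, φ, c j * j.factorial, fun x hx => ?_⟩
  simp only [Nat.add_sub_cancel]
  rw [iteratedDerivWithin_eq_iteratedDeriv uniqueDiffOn_interval hc.contDiffAt hx,
    iteratedDeriv_primitive_add_polynomial φ le_rfl, Nat.sub_self, primitive_zero_eq φ hx,
    Finset.sum_range_succ, Finset.sum_eq_zero]
  · simp only [Nat.sub_self, pow_zero, Nat.descFactorial_self]
    ring
  · intro k hk
    rw [Nat.descFactorial_of_lt (Finset.mem_range.mp hk)]
    simp

/-- Taylor's formula in `H^p(0, 2π)`. -/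
theorem eq_A_weakDeriv_add_taylor {p : ℕ} (hp : 1 ≤ p) {y : L2} (hy : MemH p y) :
    y = A p (weakDeriv p y) + taylor p fun k => initialValue p k y := by
  obtain ⟨j, rfl⟩ := Nat.exists_eq_add_of_le' hp
  obtain ⟨c, hc⟩ := exists_eq_A_add_polynomial hy
  set φ := weakDeriv (j + 1) y with hφ
  set u : ℝ → ℝ := fun x => primitive φ j x + ∑ k ∈ Finset.range (j + 1), c k * x ^ k with hu
  have hyu : y =ᵐ[μ] u := by
    have h1 := Lp.coeFn_add (A (j + 1) φ) (∑ k ∈ Finset.range (j + 1), c k • monomial k)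
    rw [← hc] at h1
    filter_upwards [h1, coeFn_A_eq_primitive φ j, coeFn_sum_smul_monomial (Finset.range (j + 1)) c]
      with x h1 h2 h3
    rw [h1, Pi.add_apply, h2, h3]
  have hE := fineRep_eqOn (memU_primitive_add_polynomial φ j c) hyu
  have h0 : (0 : ℝ) ∈ Icc 0 (2 * Real.pi) := ⟨le_rfl, Real.two_pi_pos.le⟩
  have hI : ∀ i ∈ Finset.range (j + 1), initialValue (j + 1) i y = c i * i.factorial := by
    intro i hi
    have hij : i ≤ j := Nat.lt_succ_iff.mp (Finset.mem_range.mp hi)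
    have hcd : ContDiff ℝ i u := ((contDiff_primitive φ j).of_le (by exact_mod_cast hij)).add
      (contDiff_sum_mul_pow _ _ _)
    unfold initialValue
    rw [iteratedDerivWithin_congr hE h0,
      iteratedDerivWithin_eq_iteratedDeriv uniqueDiffOn_interval hcd.contDiffAt h0, hu,
      iteratedDeriv_primitive_add_polynomial φ hij, primitive_zero_right, zero_add,
      -- At 0 only the monomial of degree i survives: lower degrees are differentiated away, higher
      -- ones vanish.
      Finset.sum_eq_single_of_mem i hi]
    · simp [Nat.descFactorial_self]
    · intro k _ hk
      rcases lt_or_gt_of_ne hk with h | h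
      · rw [Nat.descFactorial_of_lt h]
        simp
      · rw [zero_pow (by omega)]
        simp
  refine hc.trans ?_
  unfold taylor
  congr 1
  refine Finset.sum_congr rfl fun k hk => ?_
  beta_reduce
  rw [hI k hk, mul_div_cancel_right₀ _ (by positivity)]

/-! ### The Galerkin solution and the error estimate. -/

/-- One constant serves both the noise (against C) and the approximation error (against γ): √3, 5.2
and 28. For p = 1 it equals C, and (√3 - 1)² π² ≤ 6 gives the comparison with γ. -/
theorem exists_stability_const {p : ℕ} (hp : p = 1 ∨ p = 2 ∨ p = 3) {n : ℕ} (hn : 1 ≤ n) :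
    ∃ c : ℝ, 0 ≤ c ∧ c ≤ constC p ∧ c ≤ constGamma p ∧
      ∀ x ψ h : L2, GalerkinEq p n x ψ h → ‖x‖ ≤ c * ((n : ℝ) ^ p * ‖h‖ + ‖ψ‖) := by
  obtain ⟨-, hπ, -⟩ := sq_pi_bounds
  have hpi := Real.pi_pos
  have hγ : ∀ (q : ℕ) (c : ℝ), (c - 1) ^ 2 ≤ kappaSq q → c ≤ constGamma q := by
    intro q c h
    have := Real.le_sqrt_of_sq_le h
    unfold constGamma
    linarith
  have s2 : √(2 : ℝ) ^ 2 = 2 := Real.sq_sqrt (by norm_num)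
  have s3 : √(3 : ℝ) ^ 2 = 3 := Real.sq_sqrt (by norm_num)
  rcases hp with rfl | rfl | rfl
  · refine ⟨√3, by positivity, by simp [constC], hγ _ _ ?_, fun x ψ h H => H.norm_le_one hn⟩
    have h1 : (1.73 : ℝ) ≤ √3 := Real.le_sqrt_of_sq_le (by norm_num)
    have h2 : kappaSq 1 = 6 / Real.pi ^ 2 := by
      simp only [kappaSq, if_true, div_pow, s2]
      ring
    rw [h2, le_div_iff₀ (by positivity)]
    have h3 : Real.pi ^ 2 ≤ 3.15 ^ 2 := pow_le_pow_left₀ hpi.le hπ.le 2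
    have h4 : (√3 - 1) ^ 2 ≤ 0.54 := by
      rw [sub_sq, s3]
      linarith
    calc (√3 - 1) ^ 2 * Real.pi ^ 2 ≤ 0.54 * 3.15 ^ 2 :=
          mul_le_mul h4 h3 (by positivity) (by norm_num)
      _ ≤ 6 := by norm_num
  · refine ⟨5.2, by norm_num, by norm_num [constC], hγ _ _ ?_, fun x ψ h H => H.norm_le_two hn⟩
    have h2 : kappaSq 2 = √2 ^ 2 + 2 ^ 2 + Real.pi ^ 2 + (3 * √2 / 2) ^ 2 + 3 ^ 2 + 5 ^ 2 := by
      simp [kappaSq]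
    rw [h2, s2]
    have := sq_nonneg Real.pi
    have := sq_nonneg (3 * √2 / 2)
    norm_num at *
    linarith
  · refine ⟨28, by norm_num, by norm_num [constC], hγ _ _ ?_, fun x ψ h H => H.norm_le_three hn⟩
    have h2 : kappaSq 3 = (11 * √2) ^ 2 + 23 ^ 2 + (11 * Real.pi) ^ 2 + (44 * √2 / 3) ^ 2
        + 30 ^ 2 + 48 ^ 2 := by
      simp [kappaSq]
    rw [h2]
    have := sq_nonneg (11 * √2)
    have := sq_nonneg (11 * Real.pi)
    have := sq_nonneg (44 * √2 / 3)
    norm_num at *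
    linarith

/-- The stability estimate with ψ = 0 and h = 0. -/
theorem An_injective {p : ℕ} (hp : p = 1 ∨ p = 2 ∨ p = 3) {n : ℕ} (hn : 1 ≤ n) :
    Function.Injective (An p n) := by
  obtain ⟨c, -, -, -, hc⟩ := exists_stability_const hp hn
  refine (injective_iff_map_eq_zero _).mpr fun x hx => ?_
  have hP : P n (A p (x : L2)) = 0 := hx
  have H : GalerkinEq p n (x : L2) 0 0 := by
    refine ⟨x.2, Submodule.zero_mem _, ?_, ?_, ?_, ?_⟩
    · intro k _
      rw [fourierCos_eq_inner, inner_zero_right]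
    · intro k _
      rw [fourierSin_eq_inner, inner_zero_right]
    · intro k hk
      rw [sub_zero, ← fourierCos_P hk (A p x), hP, ZeroMemClass.coe_zero]
    · intro k hk
      rw [sub_zero, ← fourierSin_P hk (A p x), hP, ZeroMemClass.coe_zero]
  have h := hc _ _ _ H
  rw [norm_zero, mul_zero, zero_add, mul_zero] at h
  exact Subtype.ext (norm_le_zero_iff.mp h)

/-- For a surjective operator the Moore–Penrose inverse is a right inverse. -/
theorem map_moorePenrose {E F : Type*} [NormedAddCommGroup E] [InnerProductSpace ℝ E]
    [NormedAddCommGroup F] [InnerProductSpace ℝ F] {T : E →ₗ[ℝ] F} (hT : Function.Bijective T)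
    (b : F) : T (moorePenrose T b) = b := by
  obtain ⟨x₀, hx₀⟩ := hT.2 b
  -- The residual 0 is attained, so the minimizers are exactly the solutions.
  have hls : ∀ z, IsLeastSquares T b z → T z = b := by
    intro z hz
    have h := hz x₀
    rw [hx₀, sub_self, norm_zero] at h
    exact sub_eq_zero.mp (norm_le_zero_iff.mp h)
  have hx₀' : IsLeastSquares T b x₀ := by
    intro z
    rw [hx₀, sub_self, norm_zero]
    exact norm_nonneg _
  have h := Classical.epsilon_spec (p := fun x : E =>
    IsLeastSquares T b x ∧ ∀ z : E, IsLeastSquares T b z → ‖x‖ ≤ ‖z‖)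
    ⟨x₀, hx₀', fun z hz => by rw [hT.1 ((hls z hz).trans hx₀.symm)]⟩
  exact hls _ h.1

theorem P_A_galerkin {p : ℕ} (hp : p = 1 ∨ p = 2 ∨ p = 3) {n : ℕ} (hn : 1 ≤ n) (g : L2) :
    galerkin p n g ∈ X n ∧ P n (A p (galerkin p n g)) = P n g := by
  have hinj := An_injective hp hn
  have hbij : Function.Bijective (An p n) := ⟨hinj, LinearMap.injective_iff_surjective.mp hinj⟩
  exact ⟨Subtype.property _, map_moorePenrose hbij (P n g)⟩

theorem fourierCos_sub_P {n k : ℕ} (hk : k ≤ n) (f : L2) : fourierCos k (f - P n f) = 0 := by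
  rw [fourierCos_sub, fourierCos_P hk, sub_self]

theorem fourierSin_sub_P {n k : ℕ} (hk : k ≤ n) (f : L2) : fourierSin k (f - P n f) = 0 := by
  rw [fourierSin_sub, fourierSin_P hk, sub_self]

/-- The rate of approximation by trigonometric polynomials in the periodic Sobolev scale. -/
theorem norm_sub_P_le {n : ℕ} (hn : 1 ≤ n) {l : ℝ} (hl : 0 < l) {f : L2} (hf : MemHper l f) :
    ‖f - P n f‖ ≤ 1 / (n : ℝ) ^ l * perNorm l f := by
  have hn' : (1 : ℝ) ≤ n := by exact_mod_cast hn
  have hnl : 0 < (n : ℝ) ^ l := Real.rpow_pos_of_pos (by linarith) l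
  have h1 := hasSum_sq_tail (n := n) (f := f - P n f) (fun k hk => fourierCos_sub_P hk f)
    (fun k hk => fourierSin_sub_P hk f)
  have hterm : ∀ k, 0 ≤ perTerm l f k := fun k => by unfold perTerm; positivity
  -- For k > n the weight (1 + k²)^l is at least n^{2l}, and P_n f does not contribute.
  have h2 : ∀ i : ℕ, ((n : ℝ) ^ l) ^ 2 * (fourierCos (i + n + 1) (f - P n f) ^ 2
      + fourierSin (i + n + 1) (f - P n f) ^ 2) ≤ perTerm l f (i + n + 1) := by
    intro i
    obtain ⟨hc, hs⟩ := fourier_eq_zero_of_mem_X (show n < i + n + 1 by omega) (P n f).2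
    rw [fourierCos_sub, fourierSin_sub, hc, hs, sub_zero, sub_zero]
    unfold perTerm
    refine mul_le_mul_of_nonneg_right ?_ (by positivity)
    have e : ((n : ℝ) ^ l) ^ 2 = ((n : ℝ) ^ 2) ^ l := by
      rw [← Real.rpow_natCast, ← Real.rpow_natCast, ← Real.rpow_mul (by linarith),
        ← Real.rpow_mul (by linarith), mul_comm]
    rw [e]
    refine Real.rpow_le_rpow (by positivity) ?_ hl.le
    have h3 : (n : ℝ) ≤ (i + n + 1 : ℕ) := by exact_mod_cast (by omega : n ≤ i + n + 1)
    have h4 := pow_le_pow_left₀ (by linarith) h3 2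
    linarith
  have hsum : Summable fun i : ℕ => perTerm l f (i + n + 1) :=
    (summable_nat_add_iff n).mpr hf
  have h3 := hasSum_le h2 (h1.mul_left (((n : ℝ) ^ l) ^ 2)) hsum.hasSum
  have h4 : ∑' i : ℕ, perTerm l f (i + n + 1) ≤ ∑' k : ℕ, perTerm l f (k + 1) := by
    rw [← hf.sum_add_tsum_nat_add n]
    exact le_add_of_nonneg_left (Finset.sum_nonneg fun k _ => hterm _)
  rw [div_mul_eq_mul_div, one_mul, le_div_iff₀ hnl, mul_comm]
  unfold perNorm
  refine Real.le_sqrt_of_sq_le ?_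
  rw [mul_pow]
  linarith [sq_nonneg (fourierConst f)]

theorem norm_taylor_sub_le {p : ℕ} {Λ Λ' : ℕ → ℝ} {δ : ℝ} (h : ∀ k < p, |Λ k - Λ' k| ≤ δ) :
    ‖taylor p Λ - taylor p Λ'‖ ≤ constDelta p * δ := by
  unfold taylor constDelta
  rw [← Finset.sum_sub_distrib, Finset.sum_mul]
  refine norm_sum_le_of_le _ fun k hk => ?_
  rw [← sub_smul, ← sub_div, norm_smul, norm_div, Real.norm_eq_abs, Real.norm_natCast,
    div_mul_eq_mul_div, div_mul_eq_mul_div, mul_comm]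
  gcongr
  exact h k (Finset.mem_range.mp hk)

end NumDiff

theorem theorem7p2 (p : ℕ) (hp : p = 1 ∨ p = 2 ∨ p = 3) (n : ℕ) (hn : 1 ≤ n)
    (l : ℝ) (hl : 0 < l) (δ δi : ℝ)
    (y : NumDiff.L2) (hy : NumDiff.MemH p y)
    (hyl : NumDiff.MemHper l (NumDiff.weakDeriv p y))
    (yδ : NumDiff.L2) (hyδ : ‖yδ - y‖ ≤ δ)
    (Λ : ℕ → ℝ) (hΛ : ∀ k < p, |Λ k - NumDiff.initialValue p k y| ≤ δi) :
    ‖NumDiff.galerkin p n (yδ - NumDiff.taylor p Λ) - NumDiff.weakDeriv p y‖ ≤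
        NumDiff.constC p * (n : ℝ) ^ p * δ
          + NumDiff.constDelta p * NumDiff.constC p * (n : ℝ) ^ p * δi
          + (NumDiff.constGamma p + 1) * (1 / (n : ℝ) ^ l)
            * NumDiff.perNorm l (NumDiff.weakDeriv p y) ∧
    (δi = δ →
      ‖NumDiff.galerkin p n (yδ - NumDiff.taylor p Λ) - NumDiff.weakDeriv p y‖ ≤
        (NumDiff.constDelta p + 1) * NumDiff.constC p * (n : ℝ) ^ p * δ
          + (NumDiff.constGamma p + 1) * (1 / (n : ℝ) ^ l)
            * NumDiff.perNorm l (NumDiff.weakDeriv p y)) := by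
  open NumDiff in
  have main : ‖galerkin p n (yδ - taylor p Λ) - weakDeriv p y‖ ≤
      constC p * (n : ℝ) ^ p * δ + constDelta p * constC p * (n : ℝ) ^ p * δi
        + (constGamma p + 1) * (1 / (n : ℝ) ^ l) * perNorm l (weakDeriv p y) := by
    obtain ⟨c, hc0, hcC, hcγ, hstab⟩ := exists_stability_const hp hn
    have hT := eq_A_weakDeriv_add_taylor (by omega) hy
    have hψ := norm_sub_P_le hn hl hyl
    obtain ⟨hzX, hz⟩ := P_A_galerkin hp hn (yδ - taylor p Λ)
    set φ := weakDeriv p y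
    set z := galerkin p n (yδ - taylor p Λ)
    -- The total data error: the data equal Aφ + e by Taylor's formula.
    set e : L2 := (yδ - y) - (taylor p Λ - taylor p fun k => initialValue p k y) with he
    have heN : ‖e‖ ≤ δ + constDelta p * δi :=
      (norm_sub_le _ _).trans (add_le_add hyδ (norm_taylor_sub_le hΛ))
    have hdiff : (z - (P n φ : L2)) - (φ - P n φ) = z - φ := by abel
    have hPe : P n e = P n (A p (z - φ)) := by
      have h1 : e = (yδ - taylor p Λ) - A p φ := by
        rw [he]
        nth_rewrite 1 [hT]
        abel
      rw [h1, map_sub (P n) _ (A p φ), map_sub (A p), map_sub (P n) (A p z), hz]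
    have H : GalerkinEq p n (z - P n φ) (φ - P n φ) (P n e) := by
      refine ⟨Submodule.sub_mem _ hzX (P n φ).2, (P n e).2, fun k hk => fourierCos_sub_P hk φ,
        fun k hk => fourierSin_sub_P hk φ, fun k hk => ?_, fun k hk => ?_⟩
      · rw [hdiff, hPe, fourierCos_P hk]
      · rw [hdiff, hPe, fourierSin_P hk]
    have hx := hstab _ _ _ H
    have hPeN : ‖(P n e : L2)‖ ≤ δ + constDelta p * δi :=
      ((X n).norm_orthogonalProjectionOnto_apply_le e).trans heN
    have hzφ : ‖z - φ‖ ≤ ‖z - P n φ‖ + ‖φ - P n φ‖ := by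
      rw [← hdiff]
      exact norm_sub_le _ _
    have hnp : (0 : ℝ) ≤ (n : ℝ) ^ p := by positivity
    have h1 : c * ((n : ℝ) ^ p * ‖(P n e : L2)‖)
        ≤ constC p * ((n : ℝ) ^ p * (δ + constDelta p * δi)) :=
      mul_le_mul hcC (mul_le_mul_of_nonneg_left hPeN hnp) (by positivity) (hc0.trans hcC)
    -- The summand 1 is the distance from φ to X_n itself; c is the amplification of ψ by the
    -- scheme.
    have h2 : (c + 1) * ‖φ - P n φ‖ ≤ (constGamma p + 1) * (1 / (n : ℝ) ^ l * perNorm l φ) :=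
      mul_le_mul (by linarith) hψ (norm_nonneg _) (by linarith)
    linarith
  refine ⟨main, ?_⟩
  rintro rfl
  linarith [main]
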